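/- Consider a single harmonic oscillator with Hilbert space $\mathcal H=\ell^2(\mathbb N_0)$, Fock basis $|n\rangle$, $a|n\rangle=\sqrt n\,|n-1\rangle$, and coherent states $|\alpha\rangle=e^{-|\alpha|^2/2}\sum_{n\ge 0}\frac{\alpha^n}{\sqrt{n!}}|n\rangle$, $\alpha\in\mathbb C$. Let $\mathcal C$ (the classical states) be the trace-norm closed convex hull of $\{|\alpha\rangle\langle\alpha| : \alpha\in\mathbb C\}$; states outside $\mathcal C$ are called nonclassical. For a density operator $\rho$ let $$R^s_{\mathcal C}(\rho)=\inf\Big\{1+\lambda \;:\; \lambda\ge 0,\ \exists\,\sigma\in\mathcal C,\ \tfrac{\rho+\lambda\sigma}{1+\lambda}\in\mathcal C\Big\}\in[1,\infty]$$ be the standard robustness of nonclassicality (with $\inf\emptyset=\infty$), and let $\chi_1^\rho(\alpha)=e^{|\alpha|^2/2}\,\mathrm{Tr}\big[\rho\, e^{\alpha a^\dagger-\alpha^* a}\big]$ be the normally ordered characteristic function, where the displacement operator $e^{\alpha a^\dagger-\alpha^* a}$ is a well-defined bounded operator and the trace converges. Then, for every density operator $\rho$, $$R^s_{\mathcal C}(\rho)\;\ge\;\tfrac12\Big(\sup_{\alpha\in\mathbb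 C}|\chi_1^\rho(\alpha)|+1\Big).$$ Consequently $R^s_{\mathcal C}(\rho)=\infty$ whenever $\chi_1^\rho$ is unbounded on $\mathbb C$. Moreover $\chi_1^\rho$ is unbounded, and hence $R^s_{\mathcal C}(\rho)=\infty$, in each of the following cases: 1. $\rho=|\psi\rangle\langle\psi|$ for a unit vector $\psi$ that is a finite superposition of Fock states with $\langle n|\psi\rangle\neq0$ for some $n\ge1$ (that is, not just the vacuum); 2. $\rho=|\zeta_r\rangle\langle\zeta_r|$ with the squeezed state $|\zeta_r\rangle=e^{r(a^2-a^{\dagger2})/2}|0\rangle$, $r\in\mathbb R$, $r\ne0$ (the vector $|\zeta_r\rangle$ being well defined); 3. $\rho$ is the pure state of a cat state $|\alpha_\pm\rangle\propto|\alpha\rangle\pm|-\alpha\rangle$ with $\alpha\in\mathbb C$, $\alpha\neq0$, for either sign; 4. $\rho$ is a Gaussian state, i.e. a density operator with $\mathrm{Tr}[\rho e^{\alpha a^\dagger-\alpha^*a}]=e^{i m(\alpha)-Q(\alpha)/2}$ for a real-linear functional $m$ and a real quadratic form $Q$ on $\mathbb C\cong\mathbb R^2$, and $\rho\notin\mathcal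 C$. -/

import Mathlib

namespace BosonicMode

open scoped ENNReal NNReal

noncomputable section

/-! ### The Hilbert space of one harmonic oscillator -/

/-- The Hilbert space of a single mode, in its Fock (number) representation `ℓ²(ℕ, ℂ)`. -/
abbrev FockSpace : Type := lp (fun _ : ℕ => ℂ) 2

/-- Bounded operators on the single-mode Hilbert space. -/
abbrev Op : Type := FockSpace →L[ℂ] FockSpace

/-- The Fock state vector `|n⟩`. -/
def fock (n : ℕ) : FockSpace := lp.single 2 n (1 : ℂ)

/-- The operator `|ψ⟩⟨ψ|`. -/
def proj (ψ : FockSpace) : Op := InnerProductSpace.rankOne ℂ ψ ψ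

/-- The Fock coefficients `e^{-|α|²/2} αⁿ / √(n!)` of the coherent state `|α⟩`. -/
def coherentCoeff (α : ℂ) (n : ℕ) : ℂ :=
  (Real.exp (-‖α‖ ^ 2 / 2) : ℂ) * (α ^ n / (Real.sqrt (n.factorial : ℝ) : ℂ))

theorem coherentCoeff_memℓp (α : ℂ) : Memℓp (coherentCoeff α) 2 := by
  apply memℓp_gen
  have h : Summable fun n : ℕ =>
      Real.exp (-‖α‖ ^ 2 / 2) ^ 2 * ((‖α‖ ^ 2) ^ n / (n.factorial : ℝ)) :=
    (Real.summable_pow_div_factorial (‖α‖ ^ 2)).mul_left _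
  refine h.congr fun n => ?_
  have hs : Real.sqrt (n.factorial : ℝ) ^ 2 = (n.factorial : ℝ) := Real.sq_sqrt (by positivity)
  have h2 : ((2 : ℝ≥0∞).toReal) = ((2 : ℕ) : ℝ) := by norm_num
  rw [h2, Real.rpow_natCast, coherentCoeff, norm_mul, norm_div, norm_pow, Complex.norm_real,
    Complex.norm_real, Real.norm_of_nonneg (Real.exp_pos _).le,
    Real.norm_of_nonneg (Real.sqrt_nonneg _), mul_pow, div_pow, hs, ← pow_mul, ← pow_mul,
    mul_comm n 2]

/-- The coherent state vector `|α⟩ = e^{-|α|²/2} ∑ₙ αⁿ / √(n!) |n⟩`. -/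
def coherent (α : ℂ) : FockSpace := ⟨coherentCoeff α, coherentCoeff_memℓp α⟩

/-! ### Trace, density operators, trace norm -/

/-- The trace `∑ₙ ⟨n|T|n⟩` (of a trace class operator). -/
def tr (T : Op) : ℂ := ∑' n, inner ℂ (fock n) (T (fock n))

/-- Density operators: positive operators of trace one. -/
def IsDensity (ρ : Op) : Prop :=
  ρ.IsPositive ∧ HasSum (fun n => inner ℂ (fock n) (ρ (fock n))) (1 : ℂ)

/-- The trace norm, `‖T‖₁ = sup ∑ᵢ |⟨fᵢ, T gᵢ⟩|` over all finite orthonormal systems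
`(fᵢ)`, `(gᵢ)`; it is `∞` when `T` is not trace class. -/
def traceNorm (T : Op) : ℝ≥0∞ :=
  ⨆ (N : ℕ) (f : Fin N → FockSpace) (g : Fin N → FockSpace)
    (_ : Orthonormal ℂ f) (_ : Orthonormal ℂ g), ∑ i, ‖inner ℂ (f i) (T (g i))‖ₑ

/-- The trace-norm closure of a set of operators. -/
def traceClosure (S : Set Op) : Set Op :=
  {T | ∀ ε : ℝ≥0∞, 0 < ε → ∃ σ ∈ S, traceNorm (T - σ) < ε}

/-! ### Standard robustness and classical states -/

/-- The standard robustness of `ρ` relative to a set `F` of free states: the infimum in `[0, ∞]`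
(so `∞` if there is no feasible point) of `1 + l` over all real `l ≥ 0` such that
`(ρ + l σ) / (1 + l) ∈ F` for some `σ ∈ F`. -/
def standardRobustness (F : Set Op) (ρ : Op) : ℝ≥0∞ :=
  ⨅ (l : ℝ≥0) (_ : ∃ σ ∈ F, (1 + (l : ℝ))⁻¹ • (ρ + (l : ℝ) • σ) ∈ F), (1 + (l : ℝ≥0∞))

/-- The classical states: the trace-norm closed convex hull of the coherent states. -/
def classicalStates : Set Op :=
  traceClosure (convexHull ℝ (Set.range fun α : ℂ => proj (coherent α)))

/-! ### Ladder operators and exponentials -/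

/-- The annihilation operator acting on Fock coefficients, `(a f)ₙ = √(n+1) fₙ₊₁`. -/
def annihilation : Module.End ℂ (ℕ → ℂ) where
  toFun f n := (Real.sqrt ((n : ℝ) + 1) : ℂ) * f (n + 1)
  map_add' f g := by ext n; simp [mul_add]
  map_smul' c f := by ext n; simp [mul_left_comm]

/-- The creation operator acting on Fock coefficients, `(a† f)ₙ = √n fₙ₋₁`
(which is `0` for `n = 0`). -/
def creation : Module.End ℂ (ℕ → ℂ) where
  toFun f n := (Real.sqrt (n : ℝ) : ℂ) * f (n - 1)
  map_add' f g := by ext n; simp [mul_add]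
  map_smul' c f := by ext n; simp [mul_left_comm]

/-- `u` solves `u'(t) = A u(t)` for all real `t`, with the derivative taken in Hilbert space norm.
Here `A` is an expression in the ladder operators, taken on its maximal domain: those `ψ` in the
Fock space for which the coefficient sequence `A ψ` is again square-summable. -/
def IsOrbit (A : Module.End ℂ (ℕ → ℂ)) (u : ℝ → FockSpace) : Prop :=
  ∀ t : ℝ, ∃ v : FockSpace, (v : ℕ → ℂ) = A (u t : ℕ → ℂ) ∧ HasDerivAt u v t

/-- `ζ = e^A ψ`: the vector `ζ` is the value at time `1` of the solution of `u' = A u`, `u(0) = ψ`.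
For the skew-adjoint generators used below this is the action of the unitary `e^A`. -/
def IsExpVec (A : Module.End ℂ (ℕ → ℂ)) (ψ ζ : FockSpace) : Prop :=
  ∃ u : ℝ → FockSpace, IsOrbit A u ∧ u 0 = ψ ∧ u 1 = ζ

/-- `E = e^A` for a bounded operator `E`: it acts as `e^A` on every Fock vector. -/
def IsExpOp (A : Module.End ℂ (ℕ → ℂ)) (E : Op) : Prop :=
  ∀ n : ℕ, IsExpVec A (fock n) (E (fock n))

/-- The generator `α a† - α* a` of phase-space displacements. -/
def displacementGenerator (α : ℂ) : Module.End ℂ (ℕ → ℂ) :=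
  α • creation - (starRingEnd ℂ α) • annihilation

/-- The displacement operator `e^{α a† - α* a}`. -/
def displacement (α : ℂ) : Op := Classical.epsilon (IsExpOp (displacementGenerator α))

/-- The squeezing generator `r (a² - a†²) / 2`. -/
def squeezingGenerator (r : ℝ) : Module.End ℂ (ℕ → ℂ) :=
  ((r : ℂ) / 2) • (annihilation ^ 2 - creation ^ 2)

/-- The squeezed state vector `|ζ_r⟩ = e^{r (a² - a†²) / 2} |0⟩`. -/
def squeezed (r : ℝ) : FockSpace :=
  Classical.epsilon (IsExpVec (squeezingGenerator r) (fock 0))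

/-- The unnormalised cat state vector `|α⟩ + s |-α⟩`, for a sign `s`. -/
def catAux (s : ℤˣ) (α : ℂ) : FockSpace := coherent α + ((s : ℤ) : ℂ) • coherent (-α)

/-- The Schrödinger cat state vector, `|α⟩ ± |-α⟩` divided by its norm. -/
def cat (s : ℤˣ) (α : ℂ) : FockSpace := ((‖catAux s α‖ : ℂ)⁻¹) • catAux s α

/-! ### Characteristic functions and Gaussian states -/

/-- The (symmetrically ordered) characteristic function `Tr[ρ e^{α a† - α* a}]`. -/
def chi (ρ : Op) (α : ℂ) : ℂ := tr (ρ ∘L displacement α)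

/-- The normally ordered characteristic function `e^{|α|²/2} Tr[ρ e^{α a† - α* a}]`. -/
def chiNormal (ρ : Op) (α : ℂ) : ℂ := (Real.exp (‖α‖ ^ 2 / 2) : ℂ) * chi ρ α

/-- The normally ordered characteristic function is unbounded. -/
def UnboundedChi (ρ : Op) : Prop := ¬ BddAbove (Set.range fun α : ℂ => ‖chiNormal ρ α‖)

/-- Gaussian states: density operators whose characteristic function is a Gaussian on phase space,
`exp(i m(α) - Q(α) / 2)` with `m` real-linear and `Q` a real quadratic form in `α`. -/
def IsGaussian (ρ : Op) : Prop :=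
  IsDensity ρ ∧ ∃ (m : ℂ →ₗ[ℝ] ℝ) (Q : QuadraticForm ℝ ℂ),
    ∀ α : ℂ, chi ρ α = Complex.exp (Complex.I * (m α : ℂ) - (Q α : ℂ) / 2)

/-- The standard robustness of nonclassicality. -/
def nonclassicalityRobustness (ρ : Op) : ℝ≥0∞ := standardRobustness classicalStates ρ

end

end BosonicMode

open BosonicMode

/-!
A coherent state has `χ₁(α) = exp (α β* - α* β)`, of modulus one, and `χ₁(α)` is continuous in the
trace norm, so `|χ₁| ≤ 1` on classical states. If `(1 + λ) τ = ρ + λ σ` with `σ, τ` classical,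
then `|χ₁| ≤ 1 + 2 λ` for `ρ`, which is the lower bound on the robustness.

The exponential series of a skew-symmetric band matrix with at most linearly growing entries
converges on Fock states for short times. By skew-symmetry, pairing with these solutions shows that
any solution is unique. Displacements exist because the entries of their generators grow only like
`√n`, so that the series converges for all times; squeezed states are explicit solutions.

For a pure state `ψ`, `χ₁(α) = ⟨ψ, e^{α a†} e^{-α* a} ψ⟩`. For a finite superposition this is a
polynomial in `α, α*` with leading term `(-1)ᴺ |ψ_N|² |α|²ᴺ / N!`. For a cat state it grows
exponentially along the real line through the coherent amplitude, because of a single cross term.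
For a squeezed state, all terms of the inner product are nonnegative along the squeezing direction,
and the vacuum term already grows like a Gaussian.

For a Gaussian state, `|χ₁| = exp ((|α|² - Q(α)) / 2)`. If this is bounded then `Q - |·|²` is
nonnegative, hence a sum of squares, so `χ` is also the characteristic function of a Gaussian
mixture of coherent states, and the inversion formula shows that `ρ` is that mixture.
-/

namespace BosonicMode

open scoped ComplexConjugate ENNReal NNReal
open Filter Topology MeasureTheory ProbabilityTheory
open Finset.HasAntidiagonal (antidiagonal mem_antidiagonal)

noncomputable section

/-! ### The Fock basis -/

/-- The Fock states as a Hilbert basis; its coordinates are the entries of the sequence. -/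
def fockBasis : HilbertBasis ℕ ℂ FockSpace :=
  HilbertBasis.ofRepr (LinearIsometryEquiv.refl ℂ FockSpace)

theorem coe_fockBasis : ⇑fockBasis = fock :=
  funext fun n => (fockBasis.repr_symm_single n).symm

theorem orthonormal_fock : Orthonormal ℂ fock := coe_fockBasis ▸ fockBasis.orthonormal

theorem norm_fock (n : ℕ) : ‖fock n‖ = 1 := orthonormal_fock.1 n

theorem inner_fock_left (n : ℕ) (f : FockSpace) : inner ℂ (fock n) f = f n :=
  coe_fockBasis ▸ (fockBasis.repr_apply_apply f n).symm

theorem inner_fock_right (n : ℕ) (f : FockSpace) : inner ℂ f (fock n) = conj (f n) := by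
  rw [← inner_conj_symm, inner_fock_left]

theorem fock_apply (n m : ℕ) : fock n m = if m = n then 1 else 0 := by
  rw [← inner_fock_left, orthonormal_iff_ite.1 orthonormal_fock]

theorem hasSum_fock (f : FockSpace) : HasSum (fun n => f n • fock n) f :=
  coe_fockBasis ▸ fockBasis.hasSum_repr f

theorem dense_span_fock : Dense (Submodule.span ℂ (Set.range fock) : Set FockSpace) := by
  rw [Submodule.dense_iff_topologicalClosure_eq_top, ← coe_fockBasis, fockBasis.dense_span]

/-! ### Vector-valued power series -/

section PowerSeries

variable {E : Type*} [NormedAddCommGroup E] [NormedSpace ℂ E] {x : ℕ → E} {r : ℝ} {z : ℂ}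

/-- The sum of the power series with vector coefficients `x k`, with junk value `0` where it
diverges. -/
def powerVec (x : ℕ → E) (z : ℂ) : E := ∑' k, z ^ k • x k

theorem powerVec_zero (x : ℕ → E) : powerVec x 0 = x 0 := by
  rw [powerVec, tsum_eq_single 0 fun k hk => by rw [zero_pow hk, zero_smul], pow_zero, one_smul]

theorem norm_pow_smul_le (x : E) (hz : ‖z‖ ≤ r) (k : ℕ) : ‖z ^ k • x‖ ≤ ‖x‖ * r ^ k := by
  rw [norm_smul, norm_pow, mul_comm]
  gcongr

theorem hasSum_powerVec [CompleteSpace E] (hx : Summable fun k => ‖x k‖ * r ^ k) (hz : ‖z‖ ≤ r) :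
    HasSum (fun k => z ^ k • x k) (powerVec x z) :=
  (Summable.of_norm_bounded hx fun k => norm_pow_smul_le (x k) hz k).hasSum

theorem hasSum_deriv_powerVec [CompleteSpace E] (hx : Summable fun k => ‖x k‖ * r ^ k)
    (hz : ‖z‖ < r) :
    HasSum (fun k : ℕ => z ^ k • ((k + 1 : ℂ) • x (k + 1))) (deriv (powerVec x) z) := by
  have h := Complex.hasSum_deriv_of_summable_norm (F := fun k w => w ^ k • x k) hx
    (fun k => ((differentiable_id.pow k).smul_const (x k)).differentiableOn) Metric.isOpen_ball
    (fun k w hw => norm_pow_smul_le (x k) (mem_ball_zero_iff.1 hw).le k) (mem_ball_zero_iff.2 hz)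
  have hderiv (k : ℕ) : deriv (fun w : ℂ => w ^ k • x k) z = (k * z ^ (k - 1)) • x k :=
    ((hasDerivAt_pow k z).smul_const (x k)).deriv
  simp only [hderiv] at h
  rw [← hasSum_nat_add_iff' 1] at h
  rw [show powerVec x = fun w => ∑' k, w ^ k • x k from rfl]
  simpa [smul_smul, mul_comm] using h

theorem hasDerivAt_powerVec [CompleteSpace E] (hx : Summable fun k => ‖x k‖ * r ^ k)
    (hz : ‖z‖ < r) : HasDerivAt (powerVec x) (deriv (powerVec x) z) z :=
  ((Complex.differentiableOn_tsum_of_summable_norm (F := fun k w => w ^ k • x k) hx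
    (fun k => ((differentiable_id.pow k).smul_const (x k)).differentiableOn) Metric.isOpen_ball
    fun k _ hw => norm_pow_smul_le (x k) (mem_ball_zero_iff.1 hw).le k).differentiableAt
      (Metric.isOpen_ball.mem_nhds (mem_ball_zero_iff.2 hz))).hasDerivAt

end PowerSeries

/-! ### Linear evolution in a Hilbert space -/

section Evolution

variable {H : Type*} [NormedAddCommGroup H] [InnerProductSpace ℂ H] {G : Submodule ℂ (H × H)}

/-- The graph of `-A*`, where `G` is the graph of the possibly unbounded operator `A`. -/
def negAdjoint (G : Submodule ℂ (H × H)) : Submodule ℂ (H × H) where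
  carrier := {p | ∀ q ∈ G, inner ℂ q.2 p.1 = -inner ℂ q.1 p.2}
  add_mem' hp hp' q hq := by
    rw [Prod.fst_add, Prod.snd_add, inner_add_right, inner_add_right, hp q hq, hp' q hq, neg_add]
  zero_mem' q _ := by simp
  smul_mem' c p hp q hq := by
    rw [Prod.smul_fst, Prod.smul_snd, inner_smul_right, inner_smul_right, hp q hq, mul_neg]

theorem isClosed_negAdjoint (G : Submodule ℂ (H × H)) : IsClosed (negAdjoint G : Set (H × H)) := by
  have : (negAdjoint G : Set (H × H)) = ⋂ q ∈ G, {p | inner ℂ q.2 p.1 = -inner ℂ q.1 p.2} := by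
    ext p
    simp [negAdjoint]
  rw [this]
  exact isClosed_biInter fun q _ => isClosed_eq (by fun_prop) (by fun_prop)

/-- The curve `u` satisfies `u' = A u` at time `t`, where `G` is the graph of `A`. -/
def SolvesAt (G : Submodule ℂ (H × H)) (u : ℝ → H) (t : ℝ) : Prop :=
  ∃ v, HasDerivAt u v t ∧ (u t, v) ∈ G

namespace SolvesAt

variable {u v : ℝ → H} {t : ℝ}

theorem mono {G' : Submodule ℂ (H × H)} (hu : SolvesAt G u t) (h : G ≤ G') : SolvesAt G' u t :=
  hu.imp fun _ hv => ⟨hv.1, h hv.2⟩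

theorem sub (hu : SolvesAt G u t) (hv : SolvesAt G v t) : SolvesAt G (fun t => u t - v t) t := by
  obtain ⟨u', hu, hGu⟩ := hu
  obtain ⟨v', hv, hGv⟩ := hv
  exact ⟨u' - v', hu.sub hv, G.sub_mem hGu hGv⟩

theorem comp_sub_const {s : ℝ} (hu : SolvesAt G u (t - s)) :
    SolvesAt G (fun t => u (t - s)) t :=
  hu.imp fun _ hv => ⟨hv.1.comp_sub_const t s, hv.2⟩

theorem hasDerivAt_inner (hu : SolvesAt G u t) (hv : SolvesAt (negAdjoint G) v t) :
    HasDerivAt (fun s => inner ℂ (u s) (v s)) 0 t := by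
  obtain ⟨u', hu, hGu⟩ := hu
  obtain ⟨v', hv, hGv⟩ := hv
  have h := hu.inner ℂ hv
  rwa [hGv _ hGu, add_neg_cancel] at h

end SolvesAt

theorem inner_eq_of_solvesAt {u v : ℝ → H} {S : Set ℝ} (hS : IsOpen S) (hS' : IsPreconnected S)
    (hu : ∀ t ∈ S, SolvesAt G u t) (hv : ∀ t ∈ S, SolvesAt (negAdjoint G) v t) {s t : ℝ}
    (hs : s ∈ S) (ht : t ∈ S) : inner ℂ (u s) (v s) = inner ℂ (u t) (v t) := by
  have hderiv (r) (hr : r ∈ S) := (hu r hr).hasDerivAt_inner (hv r hr)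
  exact hS.is_const_of_deriv_eq_zero (f := fun s => inner ℂ (u s) (v s)) hS'
    (fun r hr => (hderiv r hr).differentiableAt.differentiableWithinAt)
    (fun r hr => (hderiv r hr).deriv) hs ht

/-- Pairing `u` with adjoint solutions started at a time `s` close to a zero of `u` shows that
`u s` is orthogonal to `S`. Hence the zero set of `u` is open. -/
theorem eq_zero_of_solvesAt {S : Set H} (hS : Dense (Submodule.span ℂ S : Set H)) {δ : ℝ}
    (hδ : 0 < δ)
    (hloc : ∀ x ∈ S, ∃ v, v 0 = x ∧ ∀ t, |t| < δ → SolvesAt (negAdjoint G) v t)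
    {u : ℝ → H} (hu : ∀ t, SolvesAt G u t) (h0 : u 0 = 0) (t : ℝ) : u t = 0 := by
  have hcont : Continuous u := continuous_iff_continuousAt.2 fun t =>
    have ⟨_, hv, _⟩ := hu t
    hv.continuousAt
  have hopen : IsOpen {t | u t = 0} := by
    refine Metric.isOpen_iff.2 fun t ht => ⟨δ, hδ, fun s hs => ?_⟩
    have hspan : Submodule.span ℂ S ≤ (ℂ ∙ u s)ᗮ := Submodule.span_le.2 fun x hx => by
      obtain ⟨v, rfl, hv⟩ := hloc x hx
      have hvs (τ) (hτ : τ ∈ Metric.ball s δ) :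
          SolvesAt (negAdjoint G) (fun τ => v (τ - s)) τ :=
        (hv (τ - s) hτ).comp_sub_const
      have h := inner_eq_of_solvesAt Metric.isOpen_ball (convex_ball s δ).isPreconnected
        (fun τ _ => hu τ) hvs (Metric.mem_ball_self hδ) (Metric.mem_ball_comm.1 hs)
      rw [show u t = 0 from ht, inner_zero_left, sub_self] at h
      exact Submodule.mem_orthogonal_singleton_iff_inner_right.2 h
    exact hS.eq_zero_of_inner_right (𝕜 := ℂ) fun x hx =>
      Submodule.mem_orthogonal_singleton_iff_inner_left.1 (hspan hx)
  have hclopen : IsClopen {t | u t = 0} := ⟨isClosed_eq hcont continuous_const, hopen⟩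
  exact (hclopen.eq_univ ⟨0, h0⟩).ge (Set.mem_univ t)

theorem eq_of_solvesAt {S : Set H} (hS : Dense (Submodule.span ℂ S : Set H)) {δ : ℝ} (hδ : 0 < δ)
    (hloc : ∀ x ∈ S, ∃ v, v 0 = x ∧ ∀ t, |t| < δ → SolvesAt (negAdjoint G) v t) {u v : ℝ → H}
    (hu : ∀ t, SolvesAt G u t) (hv : ∀ t, SolvesAt G v t) (h0 : u 0 = v 0) : u = v :=
  funext fun t => sub_eq_zero.1 <| eq_zero_of_solvesAt hS hδ hloc (fun t => (hu t).sub (hv t))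
    (sub_eq_zero.2 h0) t

theorem solvesAt_powerVec [CompleteSpace H] (hG : IsClosed (G : Set (H × H))) {x : ℕ → H} {r : ℝ}
    (hx : Summable fun k => ‖x k‖ * r ^ k) (hxG : ∀ k : ℕ, (x k, (k + 1 : ℂ) • x (k + 1)) ∈ G)
    {t : ℝ} (ht : |t| < r) : SolvesAt G (fun t => powerVec x (t : ℂ)) t := by
  have ht' : ‖(t : ℂ)‖ < r := by rwa [Complex.norm_real]
  refine ⟨_, by
    simpa [Function.comp_def] using
      (hasDerivAt_powerVec hx ht').scomp t Complex.ofRealCLM.hasDerivAt, ?_⟩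
  refine hG.mem_of_tendsto ((hasSum_powerVec hx ht'.le).prodMk (hasSum_deriv_powerVec hx ht'))
    (Eventually.of_forall fun s => G.sum_mem fun k _ => ?_)
  exact G.smul_mem ((t : ℂ) ^ k) (hxG k)

end Evolution

/-! ### Skew-symmetric band operators on the Fock space -/

/-- The graph of `A` on its maximal domain. -/
def maxGraph (A : Module.End ℂ (ℕ → ℂ)) : Submodule ℂ (FockSpace × FockSpace) where
  carrier := {p | (p.2 : ℕ → ℂ) = A p.1}
  add_mem' {p q} hp hq := by
    rw [Set.mem_ofPred_eq] at hp hq ⊢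
    rw [Prod.snd_add, Prod.fst_add, lp.coeFn_add, lp.coeFn_add, map_add, hp, hq]
  zero_mem' := (map_zero A).symm
  smul_mem' c p hp := by
    rw [Set.mem_ofPred_eq] at hp ⊢
    rw [Prod.smul_snd, Prod.smul_fst, lp.coeFn_smul, lp.coeFn_smul, map_smul, hp]

theorem isOrbit_iff {A : Module.End ℂ (ℕ → ℂ)} {u : ℝ → FockSpace} :
    IsOrbit A u ↔ ∀ t, SolvesAt (maxGraph A) u t :=
  forall_congr' fun _ => exists_congr fun _ => and_comm

/-- `v` is supported in `{0, …, N}` and its coefficients have `ℓ¹` norm at most `c`. -/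
def FockBound (N : ℕ) (c : ℝ) (v : FockSpace) : Prop :=
  (∀ m, N < m → v m = 0) ∧ ∑ m ∈ Finset.range (N + 1), ‖v m‖ ≤ c

namespace FockBound

variable {N N' : ℕ} {c c' : ℝ} {v v' : FockSpace}

theorem eq_sum (h : FockBound N c v) :
    v = ∑ m ∈ Finset.range (N + 1), v m • BosonicMode.fock m := by
  refine (hasSum_fock v).unique (hasSum_sum_of_ne_finset_zero fun m hm => ?_)
  rw [h.1 m (by simpa using hm), zero_smul]

theorem norm_le (h : FockBound N c v) : ‖v‖ ≤ c :=
  calc ‖v‖ = ‖∑ m ∈ Finset.range (N + 1), v m • BosonicMode.fock m‖ := congrArg _ h.eq_sum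
    _ ≤ ∑ m ∈ Finset.range (N + 1), ‖v m‖ :=
      norm_sum_le_of_le _ fun m _ => by rw [norm_smul, norm_fock, mul_one]
    _ ≤ c := h.2

theorem mono (h : FockBound N c v) (hN : N ≤ N') (hc : c ≤ c') : FockBound N' c' v := by
  refine ⟨fun m hm => h.1 m (hN.trans_lt hm), (le_of_eq ?_).trans (h.2.trans hc)⟩
  refine (Finset.sum_subset (Finset.range_mono (by omega)) fun m _ hm => ?_).symm
  rw [h.1 m (by simpa using hm), norm_zero]

theorem add (h : FockBound N c v) (h' : FockBound N c' v') : FockBound N (c + c') (v + v') := by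
  refine ⟨fun m hm => by simp [h.1 m hm, h'.1 m hm], ?_⟩
  calc ∑ m ∈ Finset.range (N + 1), ‖(v + v' : FockSpace) m‖
      ≤ ∑ m ∈ Finset.range (N + 1), (‖v m‖ + ‖v' m‖) :=
        Finset.sum_le_sum fun m _ => norm_add_le _ _
    _ ≤ c + c' := by rw [Finset.sum_add_distrib]; exact add_le_add h.2 h'.2

theorem smul (a : ℂ) (h : FockBound N c v) : FockBound N (‖a‖ * c) (a • v) := by
  refine ⟨fun m hm => by simp [h.1 m hm], ?_⟩
  calc ∑ m ∈ Finset.range (N + 1), ‖(a • v : FockSpace) m‖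
      = ‖a‖ * ∑ m ∈ Finset.range (N + 1), ‖v m‖ := by
        rw [Finset.mul_sum]; exact Finset.sum_congr rfl fun m _ => norm_smul a (v m)
    _ ≤ ‖a‖ * c := by gcongr; exact h.2

theorem sum {ι : Type*} {s : Finset ι} {c : ι → ℝ} {v : ι → FockSpace}
    (h : ∀ i ∈ s, FockBound N (c i) (v i)) : FockBound N (∑ i ∈ s, c i) (∑ i ∈ s, v i) := by
  induction s using Finset.cons_induction with
  | empty => exact ⟨fun m _ => by simp, by simp⟩
  | cons a s ha ih =>
    rw [Finset.sum_cons, Finset.sum_cons]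
    exact (h a (by simp)).add (ih fun i hi => h i (by simp [hi]))

protected theorem fock (n : ℕ) : FockBound n 1 (fock n) :=
  ⟨fun m hm => by simp [fock_apply, hm.ne'], by simp [fock_apply, apply_ite]⟩

end FockBound

/-- `A` is skew-symmetric, maps `|n⟩` to `W n`, has band width `d`, and its columns grow at most
linearly, with slope `a`. -/
structure IsSkewBand (A : Module.End ℂ (ℕ → ℂ)) (W : ℕ → FockSpace) (d : ℕ) (a b : ℝ) :
    Prop where
  coe_eq : ∀ n, (W n : ℕ → ℂ) = A (fock n)
  skew : ∀ (y : FockSpace) (n : ℕ), A y n = -inner ℂ (W n) y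
  fockBound : ∀ n : ℕ, FockBound (n + d) (a * n + b) (W n)
  slope_nonneg : 0 ≤ a

/-- The iterates `A ^ k |n⟩` of an operator of band width `d` with `A |m⟩ = W m`. -/
def bandIterate (W : ℕ → FockSpace) (d n : ℕ) : ℕ → FockSpace
  | 0 => fock n
  | k + 1 => ∑ m ∈ Finset.range (n + d * k + 1), bandIterate W d n k m • W m

/-- The exponential series `∑ₖ tᵏ / k! Aᵏ |n⟩`. -/
def expOrbit (W : ℕ → FockSpace) (d n : ℕ) (t : ℝ) : FockSpace :=
  powerVec (fun k => (k.factorial : ℂ)⁻¹ • bandIterate W d n k) t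

theorem expOrbit_zero (W : ℕ → FockSpace) (d n : ℕ) : expOrbit W d n 0 = fock n := by
  simp [expOrbit, powerVec_zero, bandIterate]

theorem summable_prod_div_factorial_mul_pow {c : ℕ → ℝ} (hc : ∀ k, 0 ≤ c k) {L r : ℝ}
    (hL : Tendsto (fun k : ℕ => c k / (k + 1)) atTop (𝓝 L)) (hr : 0 ≤ r) (hLr : L * r < 1) :
    Summable fun k => (∏ j ∈ Finset.range k, c j) / k.factorial * r ^ k := by
  obtain ⟨q, hq, hq1⟩ := exists_between hLr
  refine summable_of_ratio_norm_eventually_le hq1 ?_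
  filter_upwards [(hL.mul_const r).eventually_le_const hq] with k hk
  have hpos (k : ℕ) : 0 ≤ (∏ j ∈ Finset.range k, c j) / k.factorial * r ^ k :=
    mul_nonneg (div_nonneg (Finset.prod_nonneg fun j _ => hc j) (by positivity)) (by positivity)
  rw [Real.norm_of_nonneg (hpos _), Real.norm_of_nonneg (hpos _)]
  calc (∏ j ∈ Finset.range (k + 1), c j) / (k + 1).factorial * r ^ (k + 1)
      = c k / (k + 1) * r * ((∏ j ∈ Finset.range k, c j) / k.factorial * r ^ k) := by
        rw [Finset.prod_range_succ, Nat.factorial_succ]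
        push_cast
        field_simp
        ring
    _ ≤ q * _ := by gcongr; exact hpos k

namespace IsSkewBand

variable {A : Module.End ℂ (ℕ → ℂ)} {W : ℕ → FockSpace} {d : ℕ} {a b : ℝ}

theorem fock_mem_negAdjoint (h : IsSkewBand A W d a b) (n : ℕ) :
    (fock n, W n) ∈ negAdjoint (maxGraph A) := fun q hq => by
  rw [inner_fock_right, show (q.2 : ℕ → ℂ) = A q.1 from hq, h.skew, map_neg, inner_conj_symm]

theorem negAdjoint_le_maxGraph (h : IsSkewBand A W d a b) :
    negAdjoint (maxGraph A) ≤ maxGraph A := fun p hp => by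
  refine funext fun n => ?_
  rw [h.skew, hp (fock n, W n) (h.coe_eq n), neg_neg, inner_fock_left]

theorem bound_nonneg (h : IsSkewBand A W d a b) (n : ℕ) : 0 ≤ a * n + b :=
  (norm_nonneg _).trans (h.fockBound n).norm_le

theorem fockBound_bandIterate (h : IsSkewBand A W d a b) (n k : ℕ) :
    FockBound (n + d * k) (∏ j ∈ Finset.range k, (a * (n + d * j : ℕ) + b))
      (bandIterate W d n k) := by
  induction k with
  | zero => exact FockBound.fock n
  | succ k ih =>
    have hW (m) (hm : m ∈ Finset.range (n + d * k + 1)) :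
        FockBound (n + d * (k + 1)) (a * (n + d * k : ℕ) + b) (W m) := by
      have hm : m ≤ n + d * k := Finset.mem_range_succ_iff.1 hm
      refine (h.fockBound m).mono (by rw [mul_add]; omega) ?_
      have := h.slope_nonneg
      gcongr
    refine (FockBound.sum fun m hm => (hW m hm).smul _).mono le_rfl ?_
    rw [← Finset.sum_mul, Finset.prod_range_succ]
    exact mul_le_mul_of_nonneg_right ih.2 (h.bound_nonneg _)

theorem bandIterate_mem_negAdjoint (h : IsSkewBand A W d a b) (n k : ℕ) :
    (bandIterate W d n k, bandIterate W d n (k + 1)) ∈ negAdjoint (maxGraph A) := by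
  have hsum := Submodule.sum_mem (negAdjoint (maxGraph A)) (t := Finset.range (n + d * k + 1))
    fun m _ => Submodule.smul_mem _ (bandIterate W d n k m) (h.fock_mem_negAdjoint m)
  convert hsum
  · simpa only [Prod.smul_mk, Prod.fst_sum] using (h.fockBound_bandIterate n k).eq_sum
  · simp only [Prod.smul_mk, Prod.snd_sum, bandIterate]

theorem summable_bandIterate (h : IsSkewBand A W d a b) (n : ℕ) {r : ℝ} (hr : 0 ≤ r)
    (hd : a * d * r < 1) :
    Summable fun k => ‖(k.factorial : ℂ)⁻¹ • bandIterate W d n k‖ * r ^ k := by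
  have hlim : Tendsto (fun k : ℕ => (a * (n + d * k : ℕ) + b) / (k + 1)) atTop (𝓝 (a * d)) := by
    have h0 := ((tendsto_one_div_add_atTop_nhds_zero_nat (𝕜 := ℝ)).const_mul
      (a * n + b - a * d)).const_add (a * d)
    rw [mul_zero, add_zero] at h0
    refine h0.congr fun k => ?_
    push_cast
    field_simp
    ring
  refine .of_nonneg_of_le (fun k => by positivity) (fun k => ?_)
    (summable_prod_div_factorial_mul_pow (fun k => h.bound_nonneg _) hlim hr hd)
  rw [norm_smul, norm_inv, Complex.norm_natCast, inv_mul_eq_div]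
  gcongr
  exact (h.fockBound_bandIterate n k).norm_le

theorem solvesAt_expOrbit (h : IsSkewBand A W d a b) (n : ℕ) {t : ℝ} (ht : a * d * |t| < 1) :
    SolvesAt (negAdjoint (maxGraph A)) (expOrbit W d n) t := by
  obtain ⟨r, hr, hadr⟩ := (((continuous_const_mul (a * d)).tendsto |t|).eventually_lt_const
    ht).exists_gt
  refine solvesAt_powerVec (isClosed_negAdjoint _)
    (h.summable_bandIterate n ((abs_nonneg t).trans hr.le) hadr) (fun k => ?_) hr
  have hmem := Submodule.smul_mem _ (k.factorial : ℂ)⁻¹ (h.bandIterate_mem_negAdjoint n k)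
  convert hmem using 1
  rw [Prod.smul_mk, smul_smul, Nat.factorial_succ, Nat.cast_mul, Nat.cast_succ, mul_inv,
    mul_inv_cancel_left₀ (Nat.cast_add_one_ne_zero k)]

end IsSkewBand

/-! ### Exponentials of skew-symmetric operators -/

theorem exists_linearIsometry_of_orthonormal {H : Type*} [NormedAddCommGroup H]
    [InnerProductSpace ℂ H] [CompleteSpace H] {e : ℕ → H} (he : Orthonormal ℂ e) :
    ∃ U : FockSpace →ₗᵢ[ℂ] H, ∀ n, U (fock n) = e n := by
  refine ⟨he.orthogonalFamily.linearIsometry, fun n => ?_⟩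
  rw [fock, OrthogonalFamily.linearIsometry_apply_single]
  simp

section Exponential

variable {A : Module.End ℂ (ℕ → ℂ)}

theorem exists_linearIsometry_isExpOp (hA : negAdjoint (maxGraph A) ≤ maxGraph A)
    {v : ℕ → ℝ → FockSpace} (h0 : ∀ n, v n 0 = fock n)
    (hv : ∀ n t, SolvesAt (negAdjoint (maxGraph A)) (v n) t) :
    ∃ U : FockSpace →ₗᵢ[ℂ] FockSpace, IsExpOp A U.toContinuousLinearMap := by
  have hon : Orthonormal ℂ fun n => v n 1 := orthonormal_iff_ite.2 fun i j => by
    rw [inner_eq_of_solvesAt isOpen_univ isPreconnected_univ (fun t _ => (hv i t).mono hA)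
      (fun t _ => hv j t) (Set.mem_univ 1) (Set.mem_univ 0), h0, h0,
      orthonormal_iff_ite.1 orthonormal_fock]
  obtain ⟨U, hU⟩ := exists_linearIsometry_of_orthonormal hon
  exact ⟨U, fun n => ⟨v n, isOrbit_iff.2 fun t => (hv n t).mono hA, h0 n, (hU n).symm⟩⟩

theorem IsExpVec.unique {δ : ℝ} (hδ : 0 < δ) {v : ℕ → ℝ → FockSpace} (h0 : ∀ n, v n 0 = fock n)
    (hv : ∀ n t, |t| < δ → SolvesAt (negAdjoint (maxGraph A)) (v n) t) {ψ ζ ζ' : FockSpace}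
    (h : IsExpVec A ψ ζ) (h' : IsExpVec A ψ ζ') : ζ = ζ' := by
  obtain ⟨u, hu, rfl, rfl⟩ := h
  obtain ⟨u', hu', hu0, rfl⟩ := h'
  refine congrFun (eq_of_solvesAt dense_span_fock hδ ?_ (isOrbit_iff.1 hu) (isOrbit_iff.1 hu')
    hu0.symm) 1
  rintro _ ⟨n, rfl⟩
  exact ⟨v n, h0 n, hv n⟩

end Exponential

/-! ### Displacements -/

/-- The vector `(α a† - α* a) |n⟩`. -/
def displacementFock (α : ℂ) (n : ℕ) : FockSpace :=
  (α * √(n + 1 : ℝ)) • fock (n + 1) - (conj α * √(n : ℝ)) • fock (n - 1)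

theorem displacementGenerator_apply (α : ℂ) (f : ℕ → ℂ) (n : ℕ) :
    displacementGenerator α f n =
      α * (√(n : ℝ) * f (n - 1)) - conj α * (√(n + 1 : ℝ) * f (n + 1)) := rfl

theorem fockBound_displacementFock (α : ℂ) (n : ℕ) :
    FockBound (n + 1) (2 * ‖α‖ * √(n + 1 : ℝ)) (displacementFock α n) := by
  have hup := (FockBound.fock (n + 1)).smul (α * √(n + 1 : ℝ))
  have hdown := ((FockBound.fock (n - 1)).mono (by omega : n - 1 ≤ n + 1) le_rfl).smul
    (-(conj α * √(n : ℝ)))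
  rw [displacementFock, sub_eq_add_neg, ← neg_smul]
  refine (hup.add hdown).mono le_rfl ?_
  rw [norm_neg, norm_mul, norm_mul, RCLike.norm_conj, Complex.norm_real, Complex.norm_real,
    Real.norm_of_nonneg (Real.sqrt_nonneg _), Real.norm_of_nonneg (Real.sqrt_nonneg _)]
  have hsqrt : √(n : ℝ) ≤ √(n + 1 : ℝ) := Real.sqrt_le_sqrt (by linarith)
  linarith [mul_le_mul_of_nonneg_left hsqrt (norm_nonneg α)]

/-- The slope `a` is arbitrary because the columns grow only like `√n`. -/
theorem isSkewBand_displacementGenerator (α : ℂ) {a : ℝ} (ha : 0 < a) :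
    IsSkewBand (displacementGenerator α) (displacementFock α) 1 a (a + ‖α‖ ^ 2 / a) where
  coe_eq n := by
    ext m
    rw [displacementGenerator_apply, displacementFock, lp.coeFn_sub, lp.coeFn_smul, lp.coeFn_smul]
    simp only [Pi.sub_apply, Pi.smul_apply, fock_apply, smul_eq_mul]
    congr 1
    · rcases m with _ | m
      · simp
      · rcases eq_or_ne m n with rfl | h <;> simp [*]
    · rcases n with _ | n
      · simp
      · rcases eq_or_ne m n with rfl | h <;> simp [*]
  skew y n := by
    rw [displacementGenerator_apply, displacementFock, inner_sub_left, inner_smul_left,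
      inner_smul_left, inner_fock_left, inner_fock_left]
    simp only [map_mul, Complex.conj_ofReal, Complex.conj_conj]
    ring
  fockBound n := by
    refine (fockBound_displacementFock α n).mono le_rfl ?_
    have hsq : √(n + 1 : ℝ) ^ 2 = n + 1 := Real.sq_sqrt (by positivity)
    have hexpand : a * (√(n + 1 : ℝ) - ‖α‖ / a) ^ 2 =
        a * √(n + 1 : ℝ) ^ 2 + ‖α‖ ^ 2 / a - 2 * ‖α‖ * √(n + 1 : ℝ) := by
      field_simp
      ring
    linarith [mul_nonneg ha.le (sq_nonneg (√(n + 1 : ℝ) - ‖α‖ / a)), congrArg (a * ·) hsq]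
  slope_nonneg := ha.le

theorem solvesAt_displacementOrbit (α : ℂ) (n : ℕ) (t : ℝ) :
    SolvesAt (negAdjoint (maxGraph (displacementGenerator α))) (expOrbit (displacementFock α) 1 n)
      t := by
  refine (isSkewBand_displacementGenerator α (a := (|t| + 1)⁻¹) (by positivity)).solvesAt_expOrbit
    n ?_
  rw [Nat.cast_one, mul_one, inv_mul_lt_one₀ (by positivity)]
  exact lt_add_one _

theorem existsUnique_isExpOp_displacementGenerator (α : ℂ) :
    ∃! D : Op, IsExpOp (displacementGenerator α) D := by
  obtain ⟨U, hU⟩ := exists_linearIsometry_isExpOp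
    (isSkewBand_displacementGenerator α one_pos).negAdjoint_le_maxGraph
    (expOrbit_zero (displacementFock α) 1) (solvesAt_displacementOrbit α)
  refine ⟨_, hU, fun D hD => ContinuousLinearMap.ext_on dense_span_fock ?_⟩
  rintro _ ⟨n, rfl⟩
  exact (hD n).unique one_pos (expOrbit_zero _ 1) (fun n t _ => solvesAt_displacementOrbit α n t)
    (hU n)

theorem isExpOp_displacement (α : ℂ) : IsExpOp (displacementGenerator α) (displacement α) :=
  Classical.epsilon_spec (existsUnique_isExpOp_displacementGenerator α).exists

theorem exists_linearIsometry_eq_displacement (α : ℂ) :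
    ∃ U : FockSpace →ₗᵢ[ℂ] FockSpace, displacement α = U.toContinuousLinearMap := by
  obtain ⟨U, hU⟩ := exists_linearIsometry_isExpOp
    (isSkewBand_displacementGenerator α one_pos).negAdjoint_le_maxGraph
    (expOrbit_zero (displacementFock α) 1) (solvesAt_displacementOrbit α)
  exact ⟨U, (existsUnique_isExpOp_displacementGenerator α).unique (isExpOp_displacement α) hU⟩

theorem norm_displacement_apply (α : ℂ) (x : FockSpace) : ‖displacement α x‖ = ‖x‖ := by
  obtain ⟨U, hU⟩ := exists_linearIsometry_eq_displacement α
  rw [hU]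
  exact U.norm_map x

theorem orthonormal_displacement_fock (α : ℂ) : Orthonormal ℂ fun n => displacement α (fock n) := by
  obtain ⟨U, hU⟩ := exists_linearIsometry_eq_displacement α
  rw [hU]
  exact orthonormal_fock.comp_linearIsometry U

/-! ### Exponential vectors -/

theorem apply_eq_of_hasSum_fock {c : ℕ → ℂ} {f : FockSpace}
    (h : HasSum (fun n => c n • fock n) f) (n : ℕ) : f n = c n := by
  have hsingle := hasSum_single (f := fun m => innerSL ℂ (fock n) (c m • fock m)) n
    fun m hm => by simp [inner_fock_left, fock_apply, hm.symm]
  rw [← inner_fock_left, ← innerSL_apply_apply ℂ, (h.mapL (innerSL ℂ (fock n))).unique hsingle]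
  simp [norm_fock]

/-- The unnormalised coherent state vector `∑ₙ βⁿ / √(n!) |n⟩`. -/
def expVec (β : ℂ) : FockSpace := powerVec (fun n => (√(n.factorial : ℝ) : ℂ)⁻¹ • fock n) β

theorem sqrt_factorial_ne_zero (n : ℕ) : (√(n.factorial : ℝ) : ℂ) ≠ 0 :=
  Complex.ofReal_ne_zero.2 (by positivity)

theorem sqrt_factorial_mul_self (n : ℕ) :
    (√(n.factorial : ℝ) : ℂ) * √(n.factorial : ℝ) = n.factorial := by
  rw [← Complex.ofReal_mul, Real.mul_self_sqrt (by positivity), Complex.ofReal_natCast]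

theorem sqrt_factorial_succ (n : ℕ) :
    (√((n + 1).factorial : ℝ) : ℂ) = √(n + 1 : ℝ) * √(n.factorial : ℝ) := by
  rw [Nat.factorial_succ, Nat.cast_mul, Real.sqrt_mul (by positivity), Nat.cast_succ,
    Complex.ofReal_mul]

theorem summable_inv_sqrt_factorial_mul_pow (r : ℝ) :
    Summable fun n : ℕ => (√(n.factorial : ℝ))⁻¹ * r ^ n := by
  refine .of_norm_bounded ((Real.summable_pow_div_factorial ((2 * r) ^ 2)).add
    (summable_geometric_of_lt_one (r := 1 / 4) (by norm_num) (by norm_num))) fun n => ?_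
  have hsq : ((2 * r) ^ n / √(n.factorial : ℝ)) ^ 2 = ((2 * r) ^ 2) ^ n / n.factorial := by
    rw [div_pow, Real.sq_sqrt (by positivity), pow_right_comm]
  have hquarter : ((1 / 2 : ℝ) ^ n) ^ 2 = (1 / 4) ^ n := by rw [pow_right_comm]; norm_num
  have hprod : (√(n.factorial : ℝ))⁻¹ * r ^ n =
      (2 * r) ^ n / √(n.factorial : ℝ) * (1 / 2) ^ n := by
    rw [mul_pow, div_pow, one_pow]
    field_simp
  rw [hprod, ← hsq, ← hquarter, Real.norm_eq_abs, abs_le]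
  constructor <;> nlinarith [sq_nonneg ((2 * r) ^ n / √(n.factorial : ℝ) + (1 / 2) ^ n),
    sq_nonneg ((2 * r) ^ n / √(n.factorial : ℝ) - (1 / 2) ^ n),
    sq_nonneg ((2 * r) ^ n / √(n.factorial : ℝ)), sq_nonneg ((1 / 2 : ℝ) ^ n)]

theorem summable_norm_expVec_coeff (r : ℝ) :
    Summable fun n => ‖(√(n.factorial : ℝ) : ℂ)⁻¹ • fock n‖ * r ^ n := by
  refine (summable_inv_sqrt_factorial_mul_pow r).congr fun n => ?_
  rw [norm_smul, norm_fock, mul_one, norm_inv, Complex.norm_real,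
    Real.norm_of_nonneg (Real.sqrt_nonneg _)]

theorem expVec_apply (β : ℂ) (n : ℕ) : expVec β n = β ^ n / √(n.factorial : ℝ) := by
  have h := hasSum_powerVec (summable_norm_expVec_coeff ‖β‖) le_rfl
  simp only [smul_smul] at h
  exact (apply_eq_of_hasSum_fock h n).trans (div_eq_mul_inv _ _).symm

theorem hasSum_inner_expVec (β : ℂ) (f : FockSpace) :
    HasSum (fun n => conj β ^ n * (f n / √(n.factorial : ℝ))) (inner ℂ (expVec β) f) := by
  refine (lp.hasSum_inner (expVec β) f).congr_fun fun n => ?_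
  rw [expVec_apply, RCLike.inner_apply, map_div₀, map_pow, Complex.conj_ofReal]
  ring

theorem inner_expVec_expVec (β γ : ℂ) :
    inner ℂ (expVec β) (expVec γ) = Complex.exp (conj β * γ) := by
  have h := NormedSpace.expSeries_div_hasSum_exp (conj β * γ)
  rw [← Complex.exp_eq_exp_ℂ] at h
  refine (hasSum_inner_expVec β (expVec γ)).unique (h.congr_fun fun n => ?_)
  rw [expVec_apply, div_div, sqrt_factorial_mul_self, mul_pow, mul_div_assoc]

theorem coherent_eq_smul_expVec (α : ℂ) :
    coherent α = Complex.exp (-(conj α * α) / 2) • expVec α := by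
  ext n
  rw [lp.coeFn_smul, Pi.smul_apply, expVec_apply, smul_eq_mul, Complex.conj_mul']
  change coherentCoeff α n = _
  rw [coherentCoeff, Complex.ofReal_exp]
  push_cast
  rfl

theorem annihilation_expVec (β : ℂ) : annihilation (expVec β) = β • (expVec β : ℕ → ℂ) := by
  ext n
  change (√(n + 1 : ℝ) : ℂ) * expVec β (n + 1) = β * expVec β n
  have h0 : (√(n + 1 : ℝ) : ℂ) ≠ 0 := Complex.ofReal_ne_zero.2 (by positivity)
  have hn := sqrt_factorial_ne_zero n
  rw [expVec_apply, expVec_apply, sqrt_factorial_succ]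
  field_simp
  ring

theorem hasDerivAt_expVec (β : ℂ) : HasDerivAt expVec (deriv expVec β) β :=
  hasDerivAt_powerVec (summable_norm_expVec_coeff (‖β‖ + 1)) (lt_add_one _)

theorem coe_deriv_expVec (β : ℂ) :
    ((deriv expVec β : FockSpace) : ℕ → ℂ) = creation (expVec β) := by
  ext n
  have h := (innerSL ℂ (fock n)).hasFDerivAt.comp_hasDerivAt β (hasDerivAt_expVec β)
  have hcoord : innerSL ℂ (fock n) ∘ expVec = fun β : ℂ => β ^ n / (√(n.factorial : ℝ) : ℂ) := by
    funext γ
    rw [Function.comp_apply, innerSL_apply_apply, inner_fock_left, expVec_apply]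
  rw [hcoord, innerSL_apply_apply, inner_fock_left] at h
  rw [h.unique ((hasDerivAt_pow n β).div_const _)]
  change _ = (√(n : ℝ) : ℂ) * expVec β (n - 1)
  rcases n with _ | n
  · simp
  · have h0 : (√(n + 1 : ℝ) : ℂ) ≠ 0 := Complex.ofReal_ne_zero.2 (by positivity)
    have hn := sqrt_factorial_ne_zero n
    have hsq : (√(n + 1 : ℝ) : ℂ) * √(n + 1 : ℝ) = n + 1 := by
      rw [← Complex.ofReal_mul, Real.mul_self_sqrt (by positivity)]
      push_cast
      rfl
    rw [expVec_apply, Nat.add_sub_cancel, sqrt_factorial_succ, Nat.cast_succ, Nat.cast_succ, ← hsq]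
    field_simp

theorem eq_of_hasSum_pow_smul {𝕜 E : Type*} [NontriviallyNormedField 𝕜] [NormedAddCommGroup E]
    [NormedSpace 𝕜 E] {a b : ℕ → E} {F : 𝕜 → E} (ha : ∀ w, HasSum (fun n => w ^ n • a n) (F w))
    (hb : ∀ w, HasSum (fun n => w ^ n • b n) (F w)) : a = b := by
  have hseries {c : ℕ → E} (hc : ∀ w, HasSum (fun n => w ^ n • c n) (F w)) :
      HasFPowerSeriesAt F (fun n => ContinuousMultilinearMap.mkPiRing 𝕜 (Fin n) (c n)) 0 :=
    hasFPowerSeriesAt_iff.2 <| Eventually.of_forall fun w => by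
      simpa [FormalMultilinearSeries.coeff] using hc w
  have h := (hseries ha).eq_formalMultilinearSeries (hseries hb)
  exact funext fun n => ContinuousMultilinearMap.mkPiRing_eq_iff.1 (congrFun h n)

theorem eq_of_inner_expVec {x y : FockSpace}
    (h : ∀ β, inner ℂ (expVec β) x = inner ℂ (expVec β) y) : x = y := by
  have hx (w : ℂ) : HasSum (fun n => w ^ n • (x n / (√(n.factorial : ℝ) : ℂ)))
      (inner ℂ (expVec (conj w)) x) := by
    simpa only [smul_eq_mul, Complex.conj_conj] using hasSum_inner_expVec (conj w) x
  have hy (w : ℂ) : HasSum (fun n => w ^ n • (y n / (√(n.factorial : ℝ) : ℂ)))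
      (inner ℂ (expVec (conj w)) x) := by
    simpa only [h, smul_eq_mul, Complex.conj_conj] using hasSum_inner_expVec (conj w) y
  ext n
  exact (div_left_inj' (sqrt_factorial_ne_zero n)).1 (congrFun (eq_of_hasSum_pow_smul hx hy) n)

theorem dense_span_expVec : Dense (Submodule.span ℂ (Set.range expVec) : Set FockSpace) := by
  rw [Submodule.dense_iff_topologicalClosure_eq_top, Submodule.topologicalClosure_eq_top_iff,
    Submodule.eq_bot_iff]
  intro x hx
  refine eq_of_inner_expVec fun β => ?_
  rw [inner_zero_right]
  exact (Submodule.mem_orthogonal _ _).1 hx _ (Submodule.subset_span ⟨β, rfl⟩)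

/-! ### Displacements of exponential vectors -/

theorem displacement_fock (α : ℂ) (n : ℕ) :
    displacement α (fock n) = expOrbit (displacementFock α) 1 n 1 := by
  refine (isExpOp_displacement α n).unique one_pos (expOrbit_zero _ 1)
    (fun n t _ => solvesAt_displacementOrbit α n t) ⟨_, ?_, expOrbit_zero _ 1 n, rfl⟩
  exact isOrbit_iff.2 fun t => (solvesAt_displacementOrbit α n t).mono
    (isSkewBand_displacementGenerator α one_pos).negAdjoint_le_maxGraph

theorem displacement_apply_of_solvesAt {α : ℂ} {u : ℝ → FockSpace}
    (hu : ∀ t, SolvesAt (maxGraph (displacementGenerator α)) u t) (hnorm : ‖u 1‖ = ‖u 0‖) :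
    displacement α (u 0) = u 1 := by
  have hadj : (displacement α).adjoint (u 1) = u 0 := by
    ext n
    rw [← inner_fock_left, ContinuousLinearMap.adjoint_inner_right, displacement_fock,
      ← inner_fock_left, ← inner_conj_symm, ← inner_conj_symm (fock n),
      ← expOrbit_zero (displacementFock α) 1 n]
    exact congrArg conj <| inner_eq_of_solvesAt isOpen_univ isPreconnected_univ (fun t _ => hu t)
      (fun t _ => solvesAt_displacementOrbit α n t) (Set.mem_univ 1) (Set.mem_univ 0)
  refine eq_of_norm_le_re_inner_eq_norm_sq (𝕜 := ℂ)
    (by rw [norm_displacement_apply, hnorm]) ?_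
  rw [← ContinuousLinearMap.adjoint_inner_right, hadj, hnorm, inner_self_eq_norm_sq]

/-- By the Baker–Campbell–Hausdorff formula, this is `e^{t (α a† - α* a)}` applied to
`expVec γ`. -/
def expVecOrbit (α γ : ℂ) (t : ℝ) : FockSpace :=
  Complex.exp (-(t * (conj α * γ)) - t ^ 2 * (conj α * α) / 2) • expVec (γ + t * α)

theorem solvesAt_expVecOrbit (α γ : ℂ) (t : ℝ) :
    SolvesAt (maxGraph (displacementGenerator α)) (expVecOrbit α γ) t := by
  have hof : HasDerivAt (fun t : ℝ => (t : ℂ)) 1 t := Complex.ofRealCLM.hasDerivAt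
  have hline : HasDerivAt (fun t : ℝ => γ + t * α) α t := by
    simpa using (hof.mul_const α).const_add γ
  have hcoeff : HasDerivAt
      (fun t : ℝ => Complex.exp (-(t * (conj α * γ)) - t ^ 2 * (conj α * α) / 2))
      (Complex.exp (-(t * (conj α * γ)) - t ^ 2 * (conj α * α) / 2) *
        (-(conj α * (γ + t * α)))) t := by
    convert ((hof.mul_const (conj α * γ)).fun_neg.fun_sub
      (((hof.fun_pow 2).mul_const (conj α * α)).div_const 2)).cexp using 1
    push_cast
    ring
  refine ⟨_, hcoeff.smul ((hasDerivAt_expVec (γ + t * α)).scomp t hline), ?_⟩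
  set c := Complex.exp (-(t * (conj α * γ)) - t ^ 2 * (conj α * α) / 2)
  change ((c • α • deriv expVec (γ + t * α) +
    (c * -(conj α * (γ + t * α))) • expVec (γ + t * α) : FockSpace) : ℕ → ℂ) =
    α • creation (c • (expVec (γ + t * α) : ℕ → ℂ)) -
      conj α • annihilation (c • (expVec (γ + t * α) : ℕ → ℂ))
  rw [map_smul, map_smul, annihilation_expVec, ← coe_deriv_expVec, lp.coeFn_add, lp.coeFn_smul,
    lp.coeFn_smul, lp.coeFn_smul]
  module

theorem norm_expVecOrbit (α γ : ℂ) (t : ℝ) : ‖expVecOrbit α γ t‖ = ‖expVec γ‖ := by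
  have h : inner ℂ (expVecOrbit α γ t) (expVecOrbit α γ t) = inner ℂ (expVec γ) (expVec γ) := by
    rw [expVecOrbit, inner_smul_left, inner_smul_right, inner_expVec_expVec, inner_expVec_expVec,
      ← Complex.exp_conj, ← Complex.exp_add, ← Complex.exp_add]
    congr 1
    simp only [map_sub, map_neg, map_mul, map_div₀, map_pow, Complex.conj_conj, map_add, map_ofNat,
      Complex.conj_ofReal]
    ring
  rw [norm_eq_sqrt_re_inner (𝕜 := ℂ), h, ← norm_eq_sqrt_re_inner]

theorem displacement_expVec (α γ : ℂ) : displacement α (expVec γ) =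
    Complex.exp (-(conj α * γ) - (conj α * α) / 2) • expVec (γ + α) := by
  have h0 : expVecOrbit α γ 0 = expVec γ := by simp [expVecOrbit]
  have h := displacement_apply_of_solvesAt (solvesAt_expVecOrbit α γ)
    ((norm_expVecOrbit α γ 1).trans (norm_expVecOrbit α γ 0).symm)
  simpa [h0, expVecOrbit] using h

/-! ### The trace norm -/

theorem sum_enorm_inner_le_traceNorm {ι : Type*} (T : Op) {f g : ι → FockSpace}
    (hf : Orthonormal ℂ f) (hg : Orthonormal ℂ g) (s : Finset ι) :
    ∑ i ∈ s, ‖inner ℂ (f i) (T (g i))‖ₑ ≤ traceNorm T := by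
  have hinj : Function.Injective fun j => (s.equivFin.symm j : ι) :=
    Subtype.val_injective.comp s.equivFin.symm.injective
  rw [← Finset.sum_coe_sort, ← s.equivFin.symm.sum_comp]
  exact le_iSup_of_le s.card <| le_iSup_of_le _ <| le_iSup_of_le _ <|
    le_iSup_of_le (hf.comp _ hinj) <| le_iSup_of_le (hg.comp _ hinj) le_rfl

theorem traceNorm_le {T : Op} {C : ℝ≥0∞} (h : ∀ (N : ℕ) (f g : Fin N → FockSpace),
    Orthonormal ℂ f → Orthonormal ℂ g → ∑ i, ‖inner ℂ (f i) (T (g i))‖ₑ ≤ C) : traceNorm T ≤ C :=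
  iSup_le fun N => iSup_le fun f => iSup_le fun g => iSup_le fun hf => iSup_le fun hg =>
    h N f g hf hg

theorem traceNorm_le_ofReal {T : Op} {C : ℝ} (h : ∀ (N : ℕ) (f g : Fin N → FockSpace),
    Orthonormal ℂ f → Orthonormal ℂ g → ∑ i, ‖inner ℂ (f i) (T (g i))‖ ≤ C) :
    traceNorm T ≤ ENNReal.ofReal C := by
  refine traceNorm_le fun N f g hf hg => ?_
  simp_rw [← ofReal_norm]
  rw [← ENNReal.ofReal_sum_of_nonneg fun _ _ => norm_nonneg _]
  exact ENNReal.ofReal_le_ofReal (h N f g hf hg)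

theorem traceNorm_add_le (T S : Op) : traceNorm (T + S) ≤ traceNorm T + traceNorm S := by
  refine traceNorm_le fun N f g hf hg => ?_
  calc ∑ i, ‖inner ℂ (f i) ((T + S) (g i))‖ₑ
      ≤ ∑ i, (‖inner ℂ (f i) (T (g i))‖ₑ + ‖inner ℂ (f i) (S (g i))‖ₑ) :=
        Finset.sum_le_sum fun i _ => by
          rw [_root_.add_apply, inner_add_right]
          exact enorm_add_le _ _
    _ ≤ traceNorm T + traceNorm S := by
        rw [Finset.sum_add_distrib]
        exact add_le_add (sum_enorm_inner_le_traceNorm T hf hg _)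
          (sum_enorm_inner_le_traceNorm S hf hg _)

theorem traceNorm_smul_le (c : ℝ) (T : Op) : traceNorm (c • T) ≤ ‖c‖ₑ * traceNorm T := by
  refine traceNorm_le fun N f g hf hg => ?_
  simp only [_root_.smul_apply, inner_smul_right_eq_smul, enorm_smul]
  rw [← Finset.mul_sum]
  gcongr
  exact sum_enorm_inner_le_traceNorm T hf hg _

theorem sum_norm_inner_mul_norm_inner_le {H : Type*} [NormedAddCommGroup H]
    [InnerProductSpace ℂ H] {ι : Type*} {f g : ι → H} (hf : Orthonormal ℂ f)
    (hg : Orthonormal ℂ g) (x y : H) (s : Finset ι) :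
    ∑ i ∈ s, ‖inner ℂ (f i) x‖ * ‖inner ℂ (g i) y‖ ≤ ‖x‖ * ‖y‖ := by
  refine le_of_abs_le (abs_le_of_sq_le_sq ?_ (by positivity))
  calc (∑ i ∈ s, ‖inner ℂ (f i) x‖ * ‖inner ℂ (g i) y‖) ^ 2
      ≤ (∑ i ∈ s, ‖inner ℂ (f i) x‖ ^ 2) * ∑ i ∈ s, ‖inner ℂ (g i) y‖ ^ 2 :=
        Finset.sum_mul_sq_le_sq_mul_sq ..
    _ ≤ ‖x‖ ^ 2 * ‖y‖ ^ 2 := by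
        gcongr
        exacts [hf.sum_inner_products_le x, hg.sum_inner_products_le y]
    _ = (‖x‖ * ‖y‖) ^ 2 := (mul_pow ..).symm

theorem traceNorm_rankOne_le (x y : FockSpace) :
    traceNorm (InnerProductSpace.rankOne ℂ x y) ≤ ENNReal.ofReal (‖x‖ * ‖y‖) := by
  refine traceNorm_le_ofReal fun N f g hf hg => ?_
  simp only [InnerProductSpace.inner_right_rankOne_apply, norm_mul, norm_inner_symm y]
  exact sum_norm_inner_mul_norm_inner_le hf hg x y _

theorem traceNorm_proj_sub_le (x y : FockSpace) :
    traceNorm (proj x - proj y) ≤ ENNReal.ofReal (‖x - y‖ * (‖x‖ + ‖y‖)) := by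
  have hsplit : proj x - proj y =
      InnerProductSpace.rankOne ℂ (x - y) x + InnerProductSpace.rankOne ℂ y (x - y) := by
    simp only [proj, map_sub, _root_.sub_apply]
    abel
  rw [hsplit, mul_add, ENNReal.ofReal_add (by positivity) (by positivity), mul_comm _ ‖y‖]
  exact (traceNorm_add_le _ _).trans (add_le_add (traceNorm_rankOne_le _ _)
    (traceNorm_rankOne_le _ _))

theorem hasSum_norm_sq (f : FockSpace) : HasSum (fun n => ‖f n‖ ^ 2) (‖f‖ ^ 2) := by
  have h := lp.hasSum_norm (by norm_num) f
  simpa only [ENNReal.toReal_ofNat, Real.rpow_ofNat] using h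

theorem sum_norm_sq_apply_le {A : Op} (hA : IsSelfAdjoint A) {C : ℝ}
    (hC : HasSum (fun n => ‖A (fock n)‖ ^ 2) C) {ι : Type*} {f : ι → FockSpace}
    (hf : Orthonormal ℂ f) (s : Finset ι) : ∑ i ∈ s, ‖A (f i)‖ ^ 2 ≤ C := by
  have hcoord (x : FockSpace) (n : ℕ) : A x n = inner ℂ (A (fock n)) x := by
    rw [← inner_fock_left, ← ContinuousLinearMap.adjoint_inner_left, hA.adjoint_eq]
  refine hasSum_le (fun n => ?_) (hasSum_sum (s := s) fun i _ => hasSum_norm_sq (A (f i))) hC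
  simp only [hcoord, norm_inner_symm (A (fock n))]
  exact hf.sum_inner_products_le (A (fock n))

theorem exists_isSelfAdjoint_mul_self_eq {H : Type*} [NormedAddCommGroup H]
    [InnerProductSpace ℂ H] [CompleteSpace H] {T : H →L[ℂ] H} (hT : T.IsPositive) :
    ∃ A, IsSelfAdjoint A ∧ A * A = T := by
  rw [← ContinuousLinearMap.nonneg_iff_isPositive] at hT
  exact ⟨CFC.sqrt T, (CFC.sqrt_nonneg T).isSelfAdjoint, CFC.sqrt_mul_sqrt_self T hT⟩

/-- The positive square root `A` of `ρ` is Hilbert–Schmidt, and `⟨f, ρ g⟩ = ⟨A f, A g⟩`. -/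
theorem IsDensity.traceNorm_le {ρ : Op} (hρ : IsDensity ρ) : traceNorm ρ ≤ 1 := by
  obtain ⟨A, hA, rfl⟩ := exists_isSelfAdjoint_mul_self_eq hρ.1
  have hinner (x y : FockSpace) : inner ℂ x ((A * A) y) = inner ℂ (A x) (A y) := by
    rw [mul_apply_eq_comp, ← ContinuousLinearMap.adjoint_inner_left, hA.adjoint_eq]
  have hHS : HasSum (fun n => ‖A (fock n)‖ ^ 2) 1 := by
    have h := hρ.2.mapL Complex.reCLM
    simp only [hinner, inner_self_eq_norm_sq_to_K, Complex.reCLM_apply, Complex.one_re] at h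
    exact_mod_cast h
  rw [← ENNReal.ofReal_one]
  refine traceNorm_le_ofReal fun N f g hf hg => ?_
  calc ∑ i, ‖inner ℂ (f i) ((A * A) (g i))‖ ≤ ∑ i, (‖A (f i)‖ ^ 2 + ‖A (g i)‖ ^ 2) / 2 := by
        refine Finset.sum_le_sum fun i _ => ?_
        rw [hinner]
        refine (norm_inner_le_norm _ _).trans ?_
        linarith [two_mul_le_add_sq ‖A (f i)‖ ‖A (g i)‖]
    _ ≤ 1 := by
        rw [← Finset.sum_div, Finset.sum_add_distrib]
        linarith [sum_norm_sq_apply_le hA hHS hf Finset.univ,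
          sum_norm_sq_apply_le hA hHS hg Finset.univ]

/-- Trace class operators, as those of finite trace norm. -/
def IsTraceClass (T : Op) : Prop := traceNorm T ≠ ⊤

namespace IsTraceClass

variable {T S : Op}

theorem add (hT : IsTraceClass T) (hS : IsTraceClass S) : IsTraceClass (T + S) :=
  ne_top_of_le_ne_top (ENNReal.add_ne_top.2 ⟨hT, hS⟩) (traceNorm_add_le _ _)

theorem smul (c : ℝ) (hT : IsTraceClass T) : IsTraceClass (c • T) :=
  ne_top_of_le_ne_top (ENNReal.mul_ne_top enorm_ne_top hT) (traceNorm_smul_le _ _)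

theorem sub (hT : IsTraceClass T) (hS : IsTraceClass S) : IsTraceClass (T - S) := by
  simpa [sub_eq_add_neg] using hT.add (hS.smul (-1))

end IsTraceClass

theorem IsDensity.isTraceClass {ρ : Op} (hρ : IsDensity ρ) : IsTraceClass ρ :=
  ne_top_of_le_ne_top ENNReal.one_ne_top hρ.traceNorm_le

theorem isTraceClass_proj (ψ : FockSpace) : IsTraceClass (proj ψ) :=
  ne_top_of_le_ne_top ENNReal.ofReal_ne_top (traceNorm_rankOne_le ψ ψ)

theorem isTraceClass_of_mem_traceClosure {S : Set Op} (hS : ∀ σ ∈ S, IsTraceClass σ) {T : Op}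
    (hT : T ∈ traceClosure S) : IsTraceClass T := by
  obtain ⟨σ, hσ, hlt⟩ := hT 1 one_pos
  rw [← sub_add_cancel T σ]
  exact IsTraceClass.add hlt.ne_top (hS σ hσ)

/-! ### Characteristic functions -/

section Characteristic

variable {T S : Op}

theorem hasSum_chi (hT : IsTraceClass T) (α : ℂ) :
    HasSum (fun n => inner ℂ (fock n) (T (displacement α (fock n)))) (chi T α) := by
  refine Summable.hasSum (.of_norm (summable_of_sum_le (c := (traceNorm T).toReal)
    (fun _ => norm_nonneg _) fun s => ?_))
  rw [← ENNReal.ofReal_le_iff_le_toReal hT, ENNReal.ofReal_sum_of_nonneg fun _ _ => norm_nonneg _]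
  simp_rw [ofReal_norm]
  exact sum_enorm_inner_le_traceNorm T orthonormal_fock (orthonormal_displacement_fock α) s

theorem enorm_chi_le (hT : IsTraceClass T) (α : ℂ) : ‖chi T α‖ₑ ≤ traceNorm T :=
  le_of_tendsto (hasSum_chi hT α).enorm <| Eventually.of_forall fun s => (enorm_sum_le _ _).trans
    (sum_enorm_inner_le_traceNorm T orthonormal_fock (orthonormal_displacement_fock α) s)

theorem chi_add (hT : IsTraceClass T) (hS : IsTraceClass S) (α : ℂ) :
    chi (T + S) α = chi T α + chi S α := by
  refine (hasSum_chi (hT.add hS) α).unique (((hasSum_chi hT α).add (hasSum_chi hS α)).congr_fun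
    fun n => ?_)
  rw [_root_.add_apply, inner_add_right]

theorem chi_smul (c : ℝ) (T : Op) (α : ℂ) : chi (c • T) α = c * chi T α := by
  simp [chi, tr, ← tsum_mul_left, inner_smul_right_eq_smul]

theorem chi_sub (hT : IsTraceClass T) (hS : IsTraceClass S) (α : ℂ) :
    chi (T - S) α = chi T α - chi S α := by
  refine (hasSum_chi (hT.sub hS) α).unique (((hasSum_chi hT α).sub (hasSum_chi hS α)).congr_fun
    fun n => ?_)
  rw [_root_.sub_apply, inner_sub_right]

theorem chi_proj (ψ : FockSpace) (α : ℂ) : chi (proj ψ) α = inner ℂ ψ (displacement α ψ) := by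
  rw [← ContinuousLinearMap.adjoint_inner_left]
  refine (hasSum_chi (isTraceClass_proj ψ) α).unique <|
    (lp.hasSum_inner ((displacement α).adjoint ψ) ψ).congr_fun fun n => ?_
  rw [proj, InnerProductSpace.inner_right_rankOne_apply, RCLike.inner_apply, inner_fock_left,
    ← inner_fock_right, ContinuousLinearMap.adjoint_inner_left]

theorem norm_chiNormal (T : Op) (α : ℂ) :
    ‖chiNormal T α‖ = Real.exp (‖α‖ ^ 2 / 2) * ‖chi T α‖ := by
  rw [chiNormal, norm_mul, Complex.norm_real, Real.norm_of_nonneg (Real.exp_pos _).le]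

theorem isDensity_proj {ψ : FockSpace} (hψ : ‖ψ‖ = 1) : IsDensity (proj ψ) := by
  refine ⟨InnerProductSpace.isPositive_rankOne_self ψ, ?_⟩
  have h := lp.hasSum_inner (𝕜 := ℂ) (G := fun _ : ℕ => ℂ) ψ ψ
  rw [inner_self_eq_norm_sq_to_K, hψ, RCLike.ofReal_one, one_pow] at h
  refine h.congr_fun fun n => ?_
  rw [proj, InnerProductSpace.inner_right_rankOne_apply, inner_fock_left, inner_fock_right,
    RCLike.inner_apply]

end Characteristic

theorem inner_expVec_displacement (α β γ : ℂ) :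
    inner ℂ (expVec β) (displacement α (expVec γ)) =
      Complex.exp (-(conj α * γ) - (conj α * α) / 2 + conj β * (γ + α)) := by
  rw [displacement_expVec, inner_smul_right, inner_expVec_expVec, ← Complex.exp_add]

theorem norm_coherent (β : ℂ) : ‖coherent β‖ = 1 := by
  have h : inner ℂ (coherent β) (coherent β) = 1 := by
    rw [coherent_eq_smul_expVec, inner_smul_left, inner_smul_right, inner_expVec_expVec,
      ← Complex.exp_conj, ← Complex.exp_add, ← Complex.exp_add, ← Complex.exp_zero]
    congr 1
    simp only [map_div₀, map_neg, map_mul, Complex.conj_conj, map_ofNat]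
    ring
  rw [norm_eq_sqrt_re_inner (𝕜 := ℂ), h, RCLike.one_re, Real.sqrt_one]

theorem chi_coherent (β α : ℂ) : chi (proj (coherent β)) α =
    Complex.exp (-(conj α * α) / 2) * Complex.exp (α * conj β - conj α * β) := by
  rw [chi_proj, coherent_eq_smul_expVec, map_smul, inner_smul_left, inner_smul_right,
    inner_expVec_displacement, ← Complex.exp_conj, ← Complex.exp_add, ← Complex.exp_add,
    ← Complex.exp_add]
  congr 1
  simp only [map_div₀, map_neg, map_mul, Complex.conj_conj, map_ofNat]
  ring

theorem ofReal_exp_norm_sq (α : ℂ) :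
    (Real.exp (‖α‖ ^ 2 / 2) : ℂ) = Complex.exp (conj α * α / 2) := by
  rw [Complex.conj_mul']
  push_cast
  rfl

theorem norm_chiNormal_coherent (β α : ℂ) : ‖chiNormal (proj (coherent β)) α‖ = 1 := by
  rw [chiNormal, chi_coherent, ofReal_exp_norm_sq, ← Complex.exp_add, ← Complex.exp_add,
    Complex.norm_exp, Real.exp_eq_one_iff]
  simp only [Complex.add_re, Complex.sub_re, Complex.mul_re, Complex.conj_re, Complex.conj_im,
    Complex.div_ofNat_re, Complex.neg_re]
  ring

/-! ### Classical states and the robustness bound -/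

theorem convex_isTraceClass_norm_chiNormal_le (C : ℝ) :
    Convex ℝ {T | IsTraceClass T ∧ ∀ α, ‖chiNormal T α‖ ≤ C} := by
  rintro T ⟨hT, hTC⟩ S ⟨hS, hSC⟩ a b ha hb hab
  refine ⟨(hT.smul a).add (hS.smul b), fun α => ?_⟩
  have hcomb : chiNormal (a • T + b • S) α = a • chiNormal T α + b • chiNormal S α := by
    rw [chiNormal, chi_add (hT.smul a) (hS.smul b), chi_smul, chi_smul, chiNormal, chiNormal,
      Complex.real_smul, Complex.real_smul]
    ring
  rw [hcomb, ← mem_closedBall_zero_iff]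
  exact convex_closedBall (0 : ℂ) C (mem_closedBall_zero_iff.2 (hTC α))
    (mem_closedBall_zero_iff.2 (hSC α)) ha hb hab

theorem norm_chiNormal_le_of_mem_traceClosure {S : Set Op} {C : ℝ}
    (hS : ∀ σ ∈ S, IsTraceClass σ) (hC : ∀ σ ∈ S, ∀ α, ‖chiNormal σ α‖ ≤ C) {T : Op}
    (hT : T ∈ traceClosure S) (α : ℂ) : ‖chiNormal T α‖ ≤ C := by
  refine le_of_forall_pos_le_add fun ε hε => ?_
  obtain ⟨σ, hσ, hlt⟩ := hT (ENNReal.ofReal (ε / Real.exp (‖α‖ ^ 2 / 2)))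
    (ENNReal.ofReal_pos.2 (by positivity))
  have hsplit : chiNormal T α = chiNormal σ α + chiNormal (T - σ) α := by
    rw [chiNormal, chiNormal, chiNormal,
      chi_sub (isTraceClass_of_mem_traceClosure hS hT) (hS σ hσ)]
    ring
  have hsmall : ‖chi (T - σ) α‖ ≤ ε / Real.exp (‖α‖ ^ 2 / 2) := by
    have h := (enorm_chi_le hlt.ne_top α).trans hlt.le
    rw [← ofReal_norm] at h
    exact (ENNReal.ofReal_le_ofReal_iff (by positivity)).1 h
  rw [hsplit]
  refine (norm_add_le _ _).trans (add_le_add (hC σ hσ α) ?_)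
  rwa [norm_chiNormal, ← le_div_iff₀' (Real.exp_pos _)]

theorem convexHull_coherent_subset : convexHull ℝ (Set.range fun α : ℂ => proj (coherent α)) ⊆
    {T | IsTraceClass T ∧ ∀ α, ‖chiNormal T α‖ ≤ 1} := by
  refine convexHull_min ?_ (convex_isTraceClass_norm_chiNormal_le 1)
  rintro _ ⟨β, rfl⟩
  exact ⟨isTraceClass_proj _, fun α => (norm_chiNormal_coherent β α).le⟩

theorem isTraceClass_of_mem_classicalStates {σ : Op} (hσ : σ ∈ classicalStates) :
    IsTraceClass σ :=
  isTraceClass_of_mem_traceClosure (fun _ h => (convexHull_coherent_subset h).1) hσ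

theorem norm_chiNormal_le_one_of_mem_classicalStates {σ : Op} (hσ : σ ∈ classicalStates) (α : ℂ) :
    ‖chiNormal σ α‖ ≤ 1 :=
  norm_chiNormal_le_of_mem_traceClosure (fun _ h => (convexHull_coherent_subset h).1)
    (fun _ h => (convexHull_coherent_subset h).2) hσ α

theorem norm_chiNormal_le_of_mem_classicalStates {ρ σ : Op} (hρ : IsTraceClass ρ) {l : ℝ}
    (hl : 0 ≤ l) (hσ : σ ∈ classicalStates) (hmix : (1 + l)⁻¹ • (ρ + l • σ) ∈ classicalStates)
    (α : ℂ) : ‖chiNormal ρ α‖ ≤ 1 + 2 * l := by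
  have hl' : (1 + l : ℂ) ≠ 0 := by exact_mod_cast (by positivity : 1 + l ≠ 0)
  have hsolve : chiNormal ρ α =
      (1 + l) • chiNormal ((1 + l)⁻¹ • (ρ + l • σ)) α - l • chiNormal σ α := by
    rw [chiNormal, chiNormal, chiNormal, chi_smul,
      chi_add hρ ((isTraceClass_of_mem_classicalStates hσ).smul l), chi_smul, Complex.real_smul,
      Complex.real_smul]
    push_cast
    field_simp
    ring
  rw [hsolve]
  refine (norm_sub_le _ _).trans ?_
  rw [norm_smul, norm_smul, Real.norm_of_nonneg hl, Real.norm_of_nonneg (by positivity)]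
  nlinarith [norm_chiNormal_le_one_of_mem_classicalStates hmix α,
    norm_chiNormal_le_one_of_mem_classicalStates hσ α]

theorem iSup_enorm_chiNormal_add_one_div_two_le {ρ : Op} (hρ : IsTraceClass ρ) :
    ((⨆ α : ℂ, ‖chiNormal ρ α‖ₑ) + 1) / 2 ≤ nonclassicalityRobustness ρ := by
  refine le_iInf₂ fun l ⟨σ, hσ, hmix⟩ => ?_
  rw [ENNReal.div_le_iff two_ne_zero ENNReal.ofNat_ne_top]
  have hsup : (⨆ α : ℂ, ‖chiNormal ρ α‖ₑ) ≤ 1 + 2 * l := iSup_le fun α => by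
    have h := norm_chiNormal_le_of_mem_classicalStates hρ l.coe_nonneg hσ hmix α
    rw [← ofReal_norm]
    refine (ENNReal.ofReal_le_ofReal h).trans (le_of_eq ?_)
    rw [ENNReal.ofReal_add zero_le_one (by positivity), ENNReal.ofReal_mul (by norm_num)]
    simp
  calc (⨆ α : ℂ, ‖chiNormal ρ α‖ₑ) + 1 ≤ 1 + 2 * (l : ℝ≥0∞) + 1 := by gcongr
    _ = (1 + (l : ℝ≥0∞)) * 2 := by ring

theorem nonclassicalityRobustness_eq_top {ρ : Op} (hρ : IsTraceClass ρ) (h : UnboundedChi ρ) :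
    nonclassicalityRobustness ρ = ⊤ := by
  have hsup : (⨆ α : ℂ, ‖chiNormal ρ α‖ₑ) = ⊤ := by
    by_contra hne
    refine h ⟨(⨆ α : ℂ, ‖chiNormal ρ α‖ₑ).toReal, ?_⟩
    rintro _ ⟨α, rfl⟩
    rw [← ENNReal.ofReal_le_iff_le_toReal hne, ofReal_norm]
    exact le_iSup (fun α : ℂ => ‖chiNormal ρ α‖ₑ) α
  have hle := iSup_enorm_chiNormal_add_one_div_two_le hρ
  rwa [hsup, top_add, ENNReal.top_div_of_ne_top ENNReal.ofNat_ne_top, top_le_iff] at hle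

/-! ### Squeezing -/

/-- The vector `r (a² - a†²) / 2 |n⟩`. -/
def squeezingFock (r : ℝ) (n : ℕ) : FockSpace :=
  (r / 2 : ℂ) • ((√(n : ℝ) * √((n - 1 : ℕ) : ℝ) : ℂ) • fock (n - 2) -
    (√(n + 1 : ℝ) * √((n + 1 : ℕ) + 1 : ℝ) : ℂ) • fock (n + 2))

theorem squeezingGenerator_apply (r : ℝ) (f : ℕ → ℂ) (n : ℕ) :
    squeezingGenerator r f n =
      r / 2 * (√(n + 1 : ℝ) * (√((n + 1 : ℕ) + 1 : ℝ) * f (n + 2)) -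
        √(n : ℝ) * (√((n - 1 : ℕ) : ℝ) * f (n - 2))) := by
  rw [squeezingGenerator, pow_two, pow_two]
  rfl

theorem fockBound_squeezingFock (r : ℝ) (n : ℕ) :
    FockBound (n + 2) (|r| * n + |r|) (squeezingFock r n) := by
  have hdown := ((FockBound.fock (n - 2)).mono (by omega : n - 2 ≤ n + 2) le_rfl).smul
    (√(n : ℝ) * √((n - 1 : ℕ) : ℝ) : ℂ)
  have hup := (FockBound.fock (n + 2)).smul (-(√(n + 1 : ℝ) * √((n + 1 : ℕ) + 1 : ℝ) : ℂ))
  rw [squeezingFock, sub_eq_add_neg, ← neg_smul]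
  refine ((hdown.add hup).smul _).mono le_rfl ?_
  rw [norm_neg, ← Complex.ofReal_mul, ← Complex.ofReal_mul, Complex.norm_real, Complex.norm_real,
    Real.norm_of_nonneg (by positivity), Real.norm_of_nonneg (by positivity), norm_div,
    Complex.norm_real, Complex.norm_ofNat, Real.norm_eq_abs]
  have hle : √(n : ℝ) * √((n - 1 : ℕ) : ℝ) ≤ n :=
    calc √(n : ℝ) * √((n - 1 : ℕ) : ℝ) ≤ √(n : ℝ) * √(n : ℝ) := by gcongr; omega
      _ = n := Real.mul_self_sqrt (by positivity)
  have hle' : √(n + 1 : ℝ) * √((n + 1 : ℕ) + 1 : ℝ) ≤ n + 2 :=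
    calc √(n + 1 : ℝ) * √((n + 1 : ℕ) + 1 : ℝ) ≤ √(n + 2 : ℝ) * √(n + 2 : ℝ) :=
          mul_le_mul (Real.sqrt_le_sqrt (by linarith)) (Real.sqrt_le_sqrt (by push_cast; linarith))
            (by positivity) (by positivity)
      _ = n + 2 := Real.mul_self_sqrt (by positivity)
  calc _ ≤ |r| / 2 * (n * 1 + (n + 2) * 1) := by gcongr
    _ = |r| * n + |r| := by ring

theorem isSkewBand_squeezingGenerator (r : ℝ) :
    IsSkewBand (squeezingGenerator r) (squeezingFock r) 2 |r| |r| where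
  coe_eq n := by
    ext m
    rw [squeezingGenerator_apply, squeezingFock, lp.coeFn_smul, lp.coeFn_sub, lp.coeFn_smul,
      lp.coeFn_smul]
    simp only [Pi.sub_apply, Pi.smul_apply, fock_apply, smul_eq_mul]
    congr 2
    · rcases n with _ | _ | n
      · simp
      · simp
      · rcases eq_or_ne m n with rfl | h <;> simp [*, add_assoc, one_add_one_eq_two, mul_comm]
    · rcases m with _ | _ | m
      · simp
      · simp
      · rcases eq_or_ne m n with rfl | h <;> simp [*, add_assoc, one_add_one_eq_two, mul_comm]
  skew y n := by
    rw [squeezingGenerator_apply, squeezingFock, inner_smul_left, inner_sub_left, inner_smul_left,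
      inner_smul_left, inner_fock_left, inner_fock_left]
    simp only [map_mul, map_div₀, map_ofNat, Complex.conj_ofReal]
    ring
  fockBound := fockBound_squeezingFock r
  slope_nonneg := abs_nonneg r

/-- The vectors `√(2k)! / (2ᵏ k!) |2k⟩`, the coefficients of the power series in `z` of
`exp (z a†² / 2) |0⟩`. -/
def squeezeCoeff (k : ℕ) : FockSpace :=
  (√((2 * k).factorial : ℝ) / (2 ^ k * k.factorial) : ℂ) • fock (2 * k)

/-- The unnormalised squeezed vector `exp (z a†² / 2) |0⟩`, for `|z| < 1`. -/
def squeezeVec (z : ℂ) : FockSpace := powerVec squeezeCoeff z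

theorem norm_squeezeCoeff_le_one (k : ℕ) : ‖squeezeCoeff k‖ ≤ 1 := by
  rw [squeezeCoeff, norm_smul, norm_fock, mul_one, norm_div, Complex.norm_real,
    Real.norm_of_nonneg (Real.sqrt_nonneg _), norm_mul, norm_pow, Complex.norm_ofNat,
    Complex.norm_natCast]
  refine div_le_one_of_le₀ (Real.sqrt_le_iff.2 ⟨by positivity, ?_⟩) (by positivity)
  have h : (2 * k).factorial ≤ 4 ^ k * k.factorial ^ 2 :=
    calc (2 * k).factorial = k.centralBinom * k.factorial ^ 2 := by
          rw [pow_two, ← mul_assoc, Nat.centralBinom, ← Nat.choose_mul_factorial_mul_factorial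
            (by omega : k ≤ 2 * k), show 2 * k - k = k by omega]
      _ ≤ 4 ^ k * k.factorial ^ 2 := by gcongr; exact k.centralBinom_le_four_pow
  rw [mul_pow, ← pow_mul, mul_comm k, pow_mul]
  norm_num
  exact_mod_cast h

theorem summable_norm_squeezeCoeff {r : ℝ} (hr : 0 ≤ r) (hr1 : r < 1) :
    Summable fun k => ‖squeezeCoeff k‖ * r ^ k :=
  .of_nonneg_of_le (fun k => by positivity)
    (fun k => mul_le_of_le_one_left (by positivity) (norm_squeezeCoeff_le_one k))
    (summable_geometric_of_lt_one hr hr1)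

/-- The vectors `a² (√(2k)! / (2ᵏ k!) |2k⟩)`. -/
def lowerSqueezeCoeff : ℕ → FockSpace
  | 0 => 0
  | k + 1 => (2 * k + 1 : ℂ) • squeezeCoeff k

theorem sqrt_factorial_two_mul_succ (k : ℕ) :
    (√((2 * (k + 1)).factorial : ℝ) : ℂ) =
      √(2 * k + 2 : ℝ) * √(2 * k + 1 : ℝ) * √((2 * k).factorial : ℝ) := by
  rw [show 2 * (k + 1) = 2 * k + 1 + 1 by ring, sqrt_factorial_succ, sqrt_factorial_succ]
  push_cast
  rw [add_assoc, one_add_one_eq_two, mul_assoc]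

theorem smul_squeezingFock (r : ℝ) (k : ℕ) :
    (√((2 * k).factorial : ℝ) / (2 ^ k * k.factorial) : ℂ) • squeezingFock r (2 * k) =
      (r / 2 : ℂ) • (lowerSqueezeCoeff k - (2 * (k + 1) : ℂ) • squeezeCoeff (k + 1)) := by
  rw [squeezingFock, smul_comm, smul_sub, smul_smul, smul_smul]
  congr 2
  · rcases k with _ | k
    · simp [lowerSqueezeCoeff]
    rw [lowerSqueezeCoeff, squeezeCoeff, smul_smul, sqrt_factorial_two_mul_succ]
    congr 1
    have hsq (x : ℝ) (hx : 0 ≤ x) : (√x : ℂ) * √x = x := by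
      rw [← Complex.ofReal_mul, Real.mul_self_sqrt hx]
    have hodd := hsq (2 * k + 1) (by positivity)
    have heven := hsq (2 * k + 2) (by positivity)
    push_cast [show (2 * (k + 1) - 1 : ℕ) = 2 * k + 1 by omega, Nat.factorial_succ,
      show (2 * (k + 1) : ℝ) = 2 * k + 2 by ring] at hodd heven ⊢
    rw [div_mul_eq_mul_div, mul_div_assoc', div_eq_div_iff
      (by simp [Nat.factorial_ne_zero, Nat.cast_add_one_ne_zero])
      (by simp [Nat.factorial_ne_zero])]
    linear_combination (√((2 * k).factorial : ℝ) * k.factorial * 2 ^ k : ℂ) *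
      (heven * √(2 * k + 1 : ℝ) ^ 2 + (2 * k + 2) * hodd)
  · rw [squeezeCoeff, smul_smul, sqrt_factorial_two_mul_succ, Nat.factorial_succ]
    congr 1
    push_cast
    rw [add_assoc, one_add_one_eq_two]
    have := Nat.cast_ne_zero (R := ℂ).2 k.factorial_ne_zero
    have := Nat.cast_add_one_ne_zero (R := ℂ) k
    field_simp
    ring

theorem squeezeCoeff_mem_negAdjoint (r : ℝ) (k : ℕ) :
    (squeezeCoeff k,
      (r / 2 : ℂ) • (lowerSqueezeCoeff k - (2 * (k + 1) : ℂ) • squeezeCoeff (k + 1))) ∈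
      negAdjoint (maxGraph (squeezingGenerator r)) := by
  rw [← smul_squeezingFock, squeezeCoeff, ← Prod.smul_mk]
  exact Submodule.smul_mem _ _ ((isSkewBand_squeezingGenerator r).fock_mem_negAdjoint _)

section SqueezeVec

variable {z : ℂ}

theorem hasSum_squeezeVec (hz : ‖z‖ < 1) :
    HasSum (fun k => z ^ k • squeezeCoeff k) (squeezeVec z) :=
  hasSum_powerVec (summable_norm_squeezeCoeff (norm_nonneg z) hz) le_rfl

theorem exists_summable_norm_squeezeCoeff (hz : ‖z‖ < 1) :
    ∃ r, ‖z‖ < r ∧ Summable fun k => ‖squeezeCoeff k‖ * r ^ k :=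
  have ⟨r, hzr, hr⟩ := exists_between hz
  ⟨r, hzr, summable_norm_squeezeCoeff ((norm_nonneg z).trans hzr.le) hr⟩

theorem hasSum_deriv_squeezeVec (hz : ‖z‖ < 1) :
    HasSum (fun k : ℕ => z ^ k • ((k + 1 : ℂ) • squeezeCoeff (k + 1))) (deriv squeezeVec z) :=
  have ⟨_, hr, hs⟩ := exists_summable_norm_squeezeCoeff hz
  hasSum_deriv_powerVec hs hr

theorem hasDerivAt_squeezeVec (hz : ‖z‖ < 1) :
    HasDerivAt squeezeVec (deriv squeezeVec z) z :=
  have ⟨_, hr, hs⟩ := exists_summable_norm_squeezeCoeff hz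
  hasDerivAt_powerVec hs hr

theorem hasSum_lowerSqueezeCoeff (hz : ‖z‖ < 1) :
    HasSum (fun k => z ^ k • lowerSqueezeCoeff k)
      (z • squeezeVec z + (2 * z ^ 2) • deriv squeezeVec z) := by
  have hshift : HasSum (fun k : ℕ => z ^ k • ((k : ℂ) • squeezeCoeff k))
      (z • deriv squeezeVec z) := by
    rw [← hasSum_nat_add_iff' 1]
    simpa [pow_succ', smul_smul, mul_assoc] using (hasSum_deriv_squeezeVec hz).const_smul z
  have h := ((hasSum_squeezeVec hz).const_smul z).add (hshift.const_smul (2 * z))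
  rw [← hasSum_nat_add_iff' 1]
  convert h using 1
  · funext k
    rw [lowerSqueezeCoeff]
    module
  · rw [Finset.sum_range_one, lowerSqueezeCoeff]
    module

theorem squeezeVec_mem_negAdjoint (r : ℝ) (hz : ‖z‖ < 1) :
    (squeezeVec z, (r / 2 : ℂ) • (z • squeezeVec z - (2 * (1 - z ^ 2)) • deriv squeezeVec z)) ∈
      negAdjoint (maxGraph (squeezingGenerator r)) := by
  have h : HasSum (fun k => z ^ k • ((r / 2 : ℂ) •
      (lowerSqueezeCoeff k - (2 * (k + 1) : ℂ) • squeezeCoeff (k + 1))))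
      ((r / 2 : ℂ) • (z • squeezeVec z - (2 * (1 - z ^ 2)) • deriv squeezeVec z)) := by
    convert ((hasSum_lowerSqueezeCoeff hz).sub
      ((hasSum_deriv_squeezeVec hz).const_smul (2 : ℂ))).const_smul (r / 2 : ℂ) using 1
    · funext k
      module
    · module
  refine (isClosed_negAdjoint _).mem_of_tendsto ((hasSum_squeezeVec hz).prodMk h)
    (Eventually.of_forall fun s => Submodule.sum_mem _ fun k _ => ?_)
  exact Submodule.smul_mem _ (z ^ k) (squeezeCoeff_mem_negAdjoint r k)

end SqueezeVec

/-- The squeezed state `exp (t r (a² - a†²) / 2) |0⟩` in closed form. -/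
def squeezedOrbit (r t : ℝ) : FockSpace :=
  (((√(Real.cosh (r * t)))⁻¹ : ℝ) : ℂ) • squeezeVec ((-Real.tanh (r * t) : ℝ) : ℂ)

theorem squeezedOrbit_zero (r : ℝ) : squeezedOrbit r 0 = fock 0 := by
  simp [squeezedOrbit, squeezeVec, powerVec_zero, squeezeCoeff]

theorem norm_ofReal_neg_tanh_lt_one (x : ℝ) : ‖((-Real.tanh x : ℝ) : ℂ)‖ < 1 := by
  rw [Complex.norm_real, norm_neg, Real.norm_eq_abs]
  exact Real.abs_tanh_lt_one x

theorem hasDerivAt_neg_tanh_const_mul (r t : ℝ) : HasDerivAt (fun t => -Real.tanh (r * t))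
    (-r * (1 - (-Real.tanh (r * t)) ^ 2)) t := by
  have hcosh := (Real.cosh_pos (r * t)).ne'
  have htanh : HasDerivAt Real.tanh (1 - Real.tanh (r * t) ^ 2) (r * t) := by
    rw [funext Real.tanh_eq_sinh_div_cosh]
    refine ((Real.hasDerivAt_sinh (r * t)).div (Real.hasDerivAt_cosh (r * t)) hcosh).congr_deriv ?_
    field_simp
  exact (htanh.comp t (hasDerivAt_const_mul r)).neg.congr_deriv (by ring)

theorem hasDerivAt_inv_sqrt_cosh_const_mul (r t : ℝ) :
    HasDerivAt (fun t => (√(Real.cosh (r * t)))⁻¹)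
      (r / 2 * (-Real.tanh (r * t)) * (√(Real.cosh (r * t)))⁻¹) t := by
  have hcosh := Real.cosh_pos (r * t)
  have hsqrt := ((Real.hasDerivAt_cosh (r * t)).comp t (hasDerivAt_const_mul r)).sqrt hcosh.ne'
  refine (hsqrt.inv (Real.sqrt_pos.2 hcosh).ne').congr_deriv ?_
  have hpos := (Real.sqrt_pos.2 hcosh).ne'
  rw [Real.tanh_eq_sinh_div_cosh, Function.comp_apply, Real.sq_sqrt hcosh.le]
  field_simp

theorem solvesAt_squeezedOrbit (r t : ℝ) :
    SolvesAt (negAdjoint (maxGraph (squeezingGenerator r))) (squeezedOrbit r) t := by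
  have hz := norm_ofReal_neg_tanh_lt_one (r * t)
  have hvec : HasDerivAt (fun t => squeezeVec ((-Real.tanh (r * t) : ℝ) : ℂ)) _ t :=
    (hasDerivAt_squeezeVec hz).scomp t (hasDerivAt_neg_tanh_const_mul r t).ofReal_comp
  refine ⟨_, (hasDerivAt_inv_sqrt_cosh_const_mul r t).ofReal_comp.smul hvec, ?_⟩
  convert Submodule.smul_mem _ (((√(Real.cosh (r * t)))⁻¹ : ℝ) : ℂ)
    (squeezeVec_mem_negAdjoint r hz) using 1
  rw [Prod.smul_mk, squeezedOrbit]
  congr 1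
  push_cast
  module

theorem norm_squeezedOrbit (r t : ℝ) : ‖squeezedOrbit r t‖ = 1 := by
  have h := inner_eq_of_solvesAt isOpen_univ isPreconnected_univ
    (fun s _ => (solvesAt_squeezedOrbit r s).mono
      (isSkewBand_squeezingGenerator r).negAdjoint_le_maxGraph)
    (fun s _ => solvesAt_squeezedOrbit r s) (Set.mem_univ t) (Set.mem_univ 0)
  have hsq : ‖squeezedOrbit r t‖ ^ 2 = 1 := by
    rw [← inner_self_eq_norm_sq (𝕜 := ℂ), h, squeezedOrbit_zero, inner_self_eq_norm_sq, norm_fock,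
      one_pow]
  exact (pow_eq_one_iff_of_nonneg (norm_nonneg _) two_ne_zero).1 hsq

theorem isExpVec_squeezedOrbit (r : ℝ) :
    IsExpVec (squeezingGenerator r) (fock 0) (squeezedOrbit r 1) :=
  ⟨squeezedOrbit r, isOrbit_iff.2 fun t => (solvesAt_squeezedOrbit r t).mono
    (isSkewBand_squeezingGenerator r).negAdjoint_le_maxGraph, squeezedOrbit_zero r, rfl⟩

theorem IsExpVec.unique_squeezing {r : ℝ} {ψ ζ ζ' : FockSpace}
    (h : IsExpVec (squeezingGenerator r) ψ ζ) (h' : IsExpVec (squeezingGenerator r) ψ ζ') :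
    ζ = ζ' := by
  refine h.unique (δ := (2 * |r| + 1)⁻¹) (by positivity) (expOrbit_zero (squeezingFock r) 2)
    (fun n t ht => (isSkewBand_squeezingGenerator r).solvesAt_expOrbit n ?_) h'
  rw [inv_eq_one_div, lt_div_iff₀ (by positivity)] at ht
  push_cast
  linarith [abs_nonneg t]

theorem existsUnique_isExpVec_squeezingGenerator (r : ℝ) :
    ∃! ζ, IsExpVec (squeezingGenerator r) (fock 0) ζ :=
  ⟨_, isExpVec_squeezedOrbit r, fun _ h => h.unique_squeezing (isExpVec_squeezedOrbit r)⟩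

theorem squeezed_eq (r : ℝ) : squeezed r = squeezedOrbit r 1 :=
  IsExpVec.unique_squeezing
    (Classical.epsilon_spec (existsUnique_isExpVec_squeezingGenerator r).exists)
    (isExpVec_squeezedOrbit r)

/-! ### Characteristic functions of pure states -/

theorem unboundedChi_of_tendsto_norm {ι : Type*} {l : Filter ι} [l.NeBot] {ρ : Op} {f : ι → ℂ}
    (h : Tendsto (fun x => ‖chiNormal ρ (f x)‖) l atTop) : UnboundedChi ρ := fun hbdd =>
  not_bddAbove_of_tendsto_atTop h <|
    hbdd.mono (Set.range_subset_iff.2 fun x => Set.mem_range_self (f x))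

theorem isDensity_unboundedChi_robustness_proj {ψ : FockSpace} (hψ : ‖ψ‖ = 1)
    (h : UnboundedChi (proj ψ)) :
    IsDensity (proj ψ) ∧ UnboundedChi (proj ψ) ∧ nonclassicalityRobustness (proj ψ) = ⊤ :=
  ⟨isDensity_proj hψ, h, nonclassicalityRobustness_eq_top (isTraceClass_proj ψ) h⟩

/-- The normally ordered displacement operator `e^{α a†} e^{-α* a}`. -/
def normalDisplacement (α : ℂ) : Op := Complex.exp (conj α * α / 2) • displacement α

theorem chiNormal_proj (ψ : FockSpace) (α : ℂ) :
    chiNormal (proj ψ) α = inner ℂ ψ (normalDisplacement α ψ) := by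
  rw [chiNormal, chi_proj, ofReal_exp_norm_sq, normalDisplacement, smul_apply,
    inner_smul_right]

theorem norm_chiNormal_proj_smul (c : ℂ) (ψ : FockSpace) (α : ℂ) :
    ‖chiNormal (proj (c • ψ)) α‖ = ‖c‖ ^ 2 * ‖chiNormal (proj ψ) α‖ := by
  rw [chiNormal_proj, chiNormal_proj, map_smul, inner_smul_left, inner_smul_right, norm_mul,
    norm_mul, RCLike.norm_conj, ← mul_assoc, sq]

theorem unboundedChi_proj_smul {ψ : FockSpace} (h : UnboundedChi (proj ψ)) {c : ℂ} (hc : c ≠ 0) :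
    UnboundedChi (proj (c • ψ)) := by
  rintro ⟨M, hM⟩
  refine h ⟨M / ‖c‖ ^ 2, ?_⟩
  rintro _ ⟨α, rfl⟩
  rw [le_div_iff₀' (by positivity), ← norm_chiNormal_proj_smul]
  exact hM ⟨α, rfl⟩

theorem inner_expVec_normalDisplacement_expVec (α β γ : ℂ) :
    inner ℂ (expVec β) (normalDisplacement α (expVec γ)) =
      Complex.exp (conj β * γ + α * conj β - conj α * γ) := by
  rw [normalDisplacement, smul_apply, inner_smul_right,
    inner_expVec_displacement, ← Complex.exp_add]
  ring_nf

theorem inner_expVec_normalDisplacement (α β : ℂ) (ψ : FockSpace) :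
    inner ℂ (expVec β) (normalDisplacement α ψ) =
      Complex.exp (α * conj β) * inner ℂ (expVec (β - α)) ψ := by
  suffices h : innerSL ℂ (expVec β) ∘L normalDisplacement α =
      Complex.exp (α * conj β) • innerSL ℂ (expVec (β - α)) from DFunLike.congr_fun h ψ
  refine ContinuousLinearMap.ext_on dense_span_expVec ?_
  rintro _ ⟨γ, rfl⟩
  simp only [ContinuousLinearMap.comp_apply, smul_apply, innerSL_apply_apply,
    smul_eq_mul, inner_expVec_normalDisplacement_expVec, inner_expVec_expVec, map_sub]
  rw [← Complex.exp_add]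
  ring_nf

/-- The Bargmann function of a vector, the entire function `w ↦ ∑ₙ ψₙ wⁿ / √(n!)`. Normally ordered
displacements act on it by a translation and multiplication by an exponential. -/
def bargmann (ψ : FockSpace) (w : ℂ) : ℂ := inner ℂ (expVec (conj w)) ψ

theorem hasSum_bargmann (ψ : FockSpace) (w : ℂ) :
    HasSum (fun n => w ^ n * (ψ n / √(n.factorial : ℝ))) (bargmann ψ w) := by
  simpa only [bargmann, Complex.conj_conj] using hasSum_inner_expVec (conj w) ψ

theorem bargmann_normalDisplacement (α w : ℂ) (ψ : FockSpace) :
    bargmann (normalDisplacement α ψ) w = Complex.exp (α * w) * bargmann ψ (w - conj α) := by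
  rw [bargmann, inner_expVec_normalDisplacement, bargmann, Complex.conj_conj, map_sub,
    Complex.conj_conj]

theorem apply_eq_of_hasSum_bargmann {ψ : FockSpace} {a : ℕ → ℂ}
    (h : ∀ w, HasSum (fun n => w ^ n * a n) (bargmann ψ w)) (n : ℕ) :
    ψ n = √(n.factorial : ℝ) * a n := by
  rw [← congrFun (eq_of_hasSum_pow_smul (hasSum_bargmann ψ) h) n,
    mul_div_cancel₀ _ (sqrt_factorial_ne_zero n)]

section PowerSeriesCoefficients

variable {w : ℂ}

theorem hasSum_pow_mul_exp (b w : ℂ) :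
    HasSum (fun n : ℕ => w ^ n * (b ^ n / (n.factorial : ℂ))) (Complex.exp (b * w)) := by
  have h := NormedSpace.expSeries_div_hasSum_exp (b * w)
  rw [← Complex.exp_eq_exp_ℂ] at h
  refine h.congr_fun fun n => ?_
  rw [mul_pow, mul_comm (b ^ n), mul_div_assoc]

theorem hasSum_pow_mul_antidiagonal {a b : ℕ → ℂ} {A B : ℂ}
    (ha : HasSum (fun n => w ^ n * a n) A) (hb : HasSum (fun n => w ^ n * b n) B) :
    HasSum (fun n => w ^ n * ∑ p ∈ antidiagonal n, a p.1 * b p.2) (A * B) := by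
  rw [← ha.tsum_eq, ← hb.tsum_eq, tsum_mul_tsum_eq_tsum_sum_antidiagonal_of_summable_norm
    ha.summable.norm hb.summable.norm]
  refine (summable_norm_sum_mul_antidiagonal_of_summable_norm
    ha.summable.norm hb.summable.norm).of_norm.hasSum.congr_fun fun n => ?_
  rw [Finset.mul_sum]
  refine Finset.sum_congr rfl fun p hp => ?_
  rw [← mem_antidiagonal.1 hp, pow_add, mul_mul_mul_comm]

theorem hasSum_pow_mul_coeff (P : Polynomial ℂ) (w : ℂ) :
    HasSum (fun n => w ^ n * P.coeff n) (P.eval w) := by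
  rw [Polynomial.eval_eq_sum_range]
  simp_rw [mul_comm (P.coeff _)]
  refine hasSum_sum_of_ne_finset_zero fun n hn => ?_
  rw [Polynomial.coeff_eq_zero_of_natDegree_lt (by simpa [Nat.lt_succ_iff] using hn), mul_zero]

end PowerSeriesCoefficients

/-! ### Finite superpositions of Fock states -/

section FiniteSuperposition

open Polynomial

theorem exists_polynomial_of_mem_span_fock {ψ : FockSpace}
    (h : ψ ∈ Submodule.span ℂ (Set.range fock)) :
    ∃ P : ℂ[X], ∀ n, ψ n = √(n.factorial : ℝ) * P.coeff n := by
  induction h using Submodule.span_induction with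
  | mem x hx =>
    obtain ⟨m, rfl⟩ := hx
    refine ⟨monomial m ((√(m.factorial : ℝ) : ℂ)⁻¹), fun n => ?_⟩
    rw [fock_apply, coeff_monomial]
    rcases eq_or_ne n m with rfl | hnm
    · rw [if_pos rfl, if_pos rfl, mul_inv_cancel₀ (sqrt_factorial_ne_zero n)]
    · rw [if_neg hnm, if_neg hnm.symm, mul_zero]
  | zero => exact ⟨0, fun n => by rw [coeff_zero, mul_zero]; rfl⟩
  | add x y _ _ hx hy =>
    obtain ⟨P, hP⟩ := hx
    obtain ⟨R, hR⟩ := hy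
    exact ⟨P + R, fun n => by rw [lp.coeFn_add, Pi.add_apply, hP, hR, coeff_add, mul_add]⟩
  | smul c x _ hx =>
    obtain ⟨P, hP⟩ := hx
    exact ⟨C c * P, fun n => by
      rw [lp.coeFn_smul, Pi.smul_apply, hP, coeff_C_mul, smul_eq_mul, mul_left_comm]⟩

/-- The coefficient of `wⁿ` in `e^{-y w} P(w + y)`, as a polynomial in `y`. -/
def translateCoeff (P : ℂ[X]) (n : ℕ) : ℂ[X] :=
  ∑ p ∈ antidiagonal n, C ((-1) ^ p.1 / (p.1.factorial : ℂ)) * (X ^ p.1 * hasseDeriv p.2 P)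

theorem hasSum_pow_mul_eval_translateCoeff (P : ℂ[X]) (y w : ℂ) :
    HasSum (fun n => w ^ n * (translateCoeff P n).eval y)
      (Complex.exp (-y * w) * P.eval (w + y)) := by
  have htaylor := hasSum_pow_mul_coeff (taylor y P) w
  simp only [taylor_coeff, taylor_eval] at htaylor
  refine (hasSum_pow_mul_antidiagonal (hasSum_pow_mul_exp (-y) w) htaylor).congr_fun fun n => ?_
  rw [translateCoeff, eval_finsetSum]
  congr 1
  refine Finset.sum_congr rfl fun p _ => ?_
  rw [eval_mul, eval_mul, eval_C, eval_pow, eval_X, neg_pow y]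
  ring

theorem natDegree_X_pow_mul_hasseDeriv_le (P : ℂ[X]) (i j : ℕ) :
    (X ^ i * hasseDeriv j P).natDegree ≤ i + (P.natDegree - j) :=
  natDegree_mul_le_of_le (natDegree_X_pow_le i) (natDegree_hasseDeriv_le P j)

theorem natDegree_translateCoeff_le (P : ℂ[X]) (n : ℕ) :
    (translateCoeff P n).natDegree ≤ P.natDegree + n := by
  refine natDegree_sum_le_of_forall_le _ _ fun p hp => (natDegree_C_mul_le _ _).trans <|
    (natDegree_X_pow_mul_hasseDeriv_le P p.1 p.2).trans ?_
  have := mem_antidiagonal.1 hp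
  omega

theorem coeff_translateCoeff_natDegree_add (P : ℂ[X]) (n : ℕ) :
    (translateCoeff P n).coeff (P.natDegree + n) =
      (-1) ^ n / (n.factorial : ℂ) * P.leadingCoeff := by
  rw [translateCoeff, finsetSum_coeff, Finset.sum_eq_single (n, 0)]
  · rw [coeff_C_mul, coeff_X_pow_mul, hasseDeriv_zero', leadingCoeff]
  · intro p hp hne
    have hsum := mem_antidiagonal.1 hp
    have hp1 : p.1 ≠ n := fun h => hne (Prod.ext h (by simp only; omega))
    rcases le_or_gt p.2 P.natDegree with hle | hlt
    · rw [coeff_C_mul, coeff_eq_zero_of_natDegree_lt, mul_zero]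
      exact (natDegree_X_pow_mul_hasseDeriv_le P p.1 p.2).trans_lt (by omega)
    · rw [hasseDeriv_eq_zero_of_lt_natDegree P p.2 hlt, mul_zero, mul_zero, coeff_zero]
  · simp

/-- The function `y ↦ χ₁(-y)` of the finite superposition `∑ₙ √(n!) Pₙ |n⟩`. -/
def chiPolynomial (P : ℂ[X]) : ℂ[X] :=
  ∑ n ∈ Finset.range (P.natDegree + 1),
    C (conj (P.coeff n) * (n.factorial : ℂ)) * translateCoeff P n

theorem coeff_chiPolynomial (P : ℂ[X]) : (chiPolynomial P).coeff (P.natDegree + P.natDegree) =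
    conj P.leadingCoeff * (-1) ^ P.natDegree * P.leadingCoeff := by
  rw [chiPolynomial, finsetSum_coeff, Finset.sum_range_succ, Finset.sum_eq_zero, zero_add,
    coeff_C_mul, coeff_translateCoeff_natDegree_add, coeff_natDegree]
  · have := Nat.cast_ne_zero (R := ℂ).2 P.natDegree.factorial_ne_zero
    field_simp
  · intro n hn
    rw [coeff_C_mul, coeff_eq_zero_of_natDegree_lt (p := translateCoeff P n), mul_zero]
    exact (natDegree_translateCoeff_le P n).trans_lt
      (Nat.add_lt_add_left (Finset.mem_range.1 hn) _)

theorem chiNormal_proj_neg_ofReal {ψ : FockSpace} {P : ℂ[X]}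
    (hP : ∀ n, ψ n = √(n.factorial : ℝ) * P.coeff n) (y : ℝ) :
    chiNormal (proj ψ) (-y) = (chiPolynomial P).eval (y : ℂ) := by
  have hbargmann (w : ℂ) : bargmann ψ w = P.eval w :=
    (hasSum_bargmann ψ w).unique <| (hasSum_pow_mul_coeff P w).congr_fun fun n => by
      rw [hP, mul_div_cancel_left₀ _ (sqrt_factorial_ne_zero n)]
  have hdisp : ∀ n, normalDisplacement (-y) ψ n =
      √(n.factorial : ℝ) * (translateCoeff P n).eval (y : ℂ) :=
    apply_eq_of_hasSum_bargmann fun w => by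
      rw [bargmann_normalDisplacement, hbargmann, map_neg, Complex.conj_ofReal, sub_neg_eq_add]
      exact hasSum_pow_mul_eval_translateCoeff P y w
  rw [chiNormal_proj, chiPolynomial, eval_finsetSum]
  refine (lp.hasSum_inner ψ (normalDisplacement (-y) ψ)).unique <|
    (hasSum_sum_of_ne_finset_zero fun n hn => ?_).congr_fun fun n => ?_
  rotate_left
  · rw [RCLike.inner_apply, hdisp, hP, map_mul, Complex.conj_ofReal, eval_mul, eval_C,
      ← sqrt_factorial_mul_self]
    ring
  · rw [coeff_eq_zero_of_natDegree_lt (by simpa [Nat.lt_succ_iff] using hn), map_zero, zero_mul,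
      C_0, zero_mul, eval_zero]

theorem unboundedChi_proj_of_mem_span_fock {ψ : FockSpace}
    (hψ : ψ ∈ Submodule.span ℂ (Set.range fock)) (hn : ∃ n : ℕ, 1 ≤ n ∧ ψ n ≠ 0) :
    UnboundedChi (proj ψ) := by
  obtain ⟨P, hP⟩ := exists_polynomial_of_mem_span_fock hψ
  obtain ⟨n, hn1, hψn⟩ := hn
  have hPn : P.coeff n ≠ 0 := right_ne_zero_of_mul (hP n ▸ hψn)
  have hdeg : 1 ≤ P.natDegree := hn1.trans (le_natDegree_of_ne_zero hPn)
  have hlead : P.leadingCoeff ≠ 0 := leadingCoeff_ne_zero.2 fun h => hPn (by rw [h, coeff_zero])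
  have htop : (chiPolynomial P).coeff (P.natDegree + P.natDegree) ≠ 0 := by
    simp [coeff_chiPolynomial, hlead]
  have hpos : 0 < (chiPolynomial P).degree :=
    natDegree_pos_iff_degree_pos.1 (lt_of_lt_of_le (by omega) (le_natDegree_of_ne_zero htop))
  refine unboundedChi_of_tendsto_norm (l := atTop) (f := fun y : ℝ => (-y : ℂ)) ?_
  simp only [chiNormal_proj_neg_ofReal hP]
  refine (chiPolynomial P).tendsto_norm_atTop hpos ?_
  simpa only [Complex.norm_real] using tendsto_norm_atTop_atTop

end FiniteSuperposition

/-! ### Cat states -/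

theorem chiNormal_proj_expVec_add_smul (s α : ℂ) (x : ℝ) :
    chiNormal (proj (expVec α + s • expVec (-α))) (x * α) =
      Real.exp (‖α‖ ^ 2) * (1 + conj s * s) + s * Real.exp ((2 * x - 1) * ‖α‖ ^ 2) +
        conj s * Real.exp (-(2 * x + 1) * ‖α‖ ^ 2) := by
  rw [chiNormal_proj, map_add, map_smul, inner_add_left, inner_add_right, inner_add_right,
    inner_smul_left, inner_smul_left, inner_smul_right, inner_smul_right]
  simp only [inner_expVec_normalDisplacement_expVec, map_neg, map_mul, Complex.conj_ofReal]
  push_cast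
  simp only [← Complex.conj_mul']
  ring_nf

theorem le_norm_chiNormal_proj_expVec_add_smul (s α : ℂ) {x : ℝ} (hx : 0 ≤ x) :
    ‖s‖ * Real.exp ((2 * x - 1) * ‖α‖ ^ 2) -
        (‖(Real.exp (‖α‖ ^ 2) * (1 + conj s * s) : ℂ)‖ + ‖s‖) ≤
      ‖chiNormal (proj (expVec α + s • expVec (-α))) (x * α)‖ := by
  rw [chiNormal_proj_expVec_add_smul]
  set A : ℂ := Real.exp (‖α‖ ^ 2) * (1 + conj s * s)
  set B : ℂ := s * Real.exp ((2 * x - 1) * ‖α‖ ^ 2) with hB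
  set D : ℂ := conj s * Real.exp (-(2 * x + 1) * ‖α‖ ^ 2) with hD
  have hBnorm : ‖B‖ = ‖s‖ * Real.exp ((2 * x - 1) * ‖α‖ ^ 2) := by
    rw [hB, norm_mul, Complex.norm_real, Real.norm_of_nonneg (Real.exp_pos _).le]
  have hDnorm : ‖D‖ ≤ ‖s‖ := by
    rw [hD, norm_mul, RCLike.norm_conj, Complex.norm_real, Real.norm_of_nonneg (Real.exp_pos _).le]
    exact mul_le_of_le_one_right (norm_nonneg s)
      (Real.exp_le_one_iff.2 (mul_nonpos_of_nonpos_of_nonneg (by linarith) (sq_nonneg _)))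
  have htri : ‖B‖ ≤ ‖A + B + D‖ + ‖A + D‖ := by
    simpa only [add_right_comm A B D, add_sub_cancel_left] using norm_sub_le (A + B + D) (A + D)
  linarith [norm_add_le A D]

theorem unboundedChi_proj_expVec_add_smul {s α : ℂ} (hs : s ≠ 0) (hα : α ≠ 0) :
    UnboundedChi (proj (expVec α + s • expVec (-α))) := by
  refine unboundedChi_of_tendsto_norm (l := atTop) (f := fun x : ℝ => x * α) ?_
  refine tendsto_atTop_mono' _ ((eventually_ge_atTop 0).mono fun x hx =>
    le_norm_chiNormal_proj_expVec_add_smul s α hx) ?_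
  refine tendsto_atTop_add_const_right _ _ ((Real.tendsto_exp_atTop.comp ?_).const_mul_atTop
    (norm_pos_iff.2 hs))
  exact (tendsto_atTop_add_const_right _ _ (tendsto_id.const_mul_atTop two_pos)).atTop_mul_const
    (by positivity)

theorem ne_zero_of_unboundedChi_proj {ψ : FockSpace} (h : UnboundedChi (proj ψ)) : ψ ≠ 0 := by
  rintro rfl
  refine h ⟨0, ?_⟩
  rintro _ ⟨α, rfl⟩
  simp [chiNormal_proj]

theorem unboundedChi_catAux (s : ℤˣ) {α : ℂ} (hα : α ≠ 0) : UnboundedChi (proj (catAux s α)) := by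
  have hcat : catAux s α = Complex.exp (-(conj α * α) / 2) •
      (expVec α + ((s : ℤ) : ℂ) • expVec (-α)) := by
    rw [catAux, coherent_eq_smul_expVec, coherent_eq_smul_expVec, map_neg, neg_mul_neg, smul_add,
      smul_comm]
  rw [hcat]
  exact unboundedChi_proj_smul
    (unboundedChi_proj_expVec_add_smul (Int.cast_ne_zero.2 s.ne_zero) hα) (Complex.exp_ne_zero _)

theorem norm_cat (s : ℤˣ) {α : ℂ} (hα : α ≠ 0) : ‖cat s α‖ = 1 :=
  norm_smul_inv_norm (ne_zero_of_unboundedChi_proj (unboundedChi_catAux s hα))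

theorem unboundedChi_cat (s : ℤˣ) {α : ℂ} (hα : α ≠ 0) : UnboundedChi (proj (cat s α)) := by
  have h := unboundedChi_catAux s hα
  refine unboundedChi_proj_smul h (inv_ne_zero ?_)
  exact_mod_cast norm_ne_zero_iff.2 (ne_zero_of_unboundedChi_proj h)

/-! ### Squeezed states -/

theorem exists_nonneg_hasSum_exp_quadratic {B T : ℝ} (hB : 0 ≤ B) (hT : 0 ≤ T) :
    ∃ c : ℕ → ℝ, (∀ n, 0 ≤ c n) ∧ c 0 = 1 ∧
      ∀ w : ℂ, HasSum (fun n => w ^ n * (c n : ℂ)) (Complex.exp (B * w + T * w ^ 2 / 2)) := by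
  let b : ℕ → ℝ := fun n => B ^ n / n.factorial
  let d : ℕ → ℝ := fun n => if Even n then (T / 2) ^ (n / 2) / (n / 2).factorial else 0
  have hb (n : ℕ) : 0 ≤ b n := by positivity
  have hd (n : ℕ) : 0 ≤ d n := by
    simp only [d]
    split_ifs <;> positivity
  have hlinear (w : ℂ) : HasSum (fun n => w ^ n * (b n : ℂ)) (Complex.exp (B * w)) :=
    (hasSum_pow_mul_exp B w).congr_fun fun n => by push_cast [b]; rfl
  have hquadratic (w : ℂ) : HasSum (fun n => w ^ n * (d n : ℂ)) (Complex.exp (T * w ^ 2 / 2)) := by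
    have heven : HasSum (fun k => w ^ (2 * k) * (d (2 * k) : ℂ))
        (Complex.exp ((T / 2 : ℝ) * w ^ 2)) :=
      (hasSum_pow_mul_exp _ (w ^ 2)).congr_fun fun k => by simp [d, pow_mul]
    have hodd : HasSum (fun k => w ^ (2 * k + 1) * (d (2 * k + 1) : ℂ)) 0 :=
      hasSum_zero.congr_fun fun k => by simp [d]
    convert HasSum.even_add_odd (f := fun n => w ^ n * (d n : ℂ)) heven hodd using 1
    rw [add_zero]
    push_cast
    rw [div_mul_eq_mul_div]
  refine ⟨fun n => ∑ p ∈ antidiagonal n, b p.1 * d p.2,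
    fun n => Finset.sum_nonneg fun p _ => mul_nonneg (hb _) (hd _), by simp [b, d], fun w => ?_⟩
  rw [Complex.exp_add]
  exact (hasSum_pow_mul_antidiagonal (hlinear w) (hquadratic w)).congr_fun fun n => by
    push_cast; rfl

theorem exists_nonneg_apply_eq_of_bargmann_eq_exp {φ : FockSpace} {B T : ℝ} (hB : 0 ≤ B)
    (hT : 0 ≤ T) {C u : ℂ}
    (h : ∀ w, bargmann φ w = C * Complex.exp (B * (u * w) + T * (u * w) ^ 2 / 2)) :
    ∃ c : ℕ → ℝ, (∀ n, 0 ≤ c n) ∧ c 0 = 1 ∧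
      ∀ n, φ n = √(n.factorial : ℝ) * (C * u ^ n * c n) := by
  obtain ⟨c, hc, hc0, hsum⟩ := exists_nonneg_hasSum_exp_quadratic hB hT
  refine ⟨c, hc, hc0, apply_eq_of_hasSum_bargmann fun w => ?_⟩
  rw [h]
  exact ((hsum (u * w)).mul_left C).congr_fun fun n => by rw [mul_pow]; ring

theorem bargmann_squeezeVec {z : ℂ} (hz : ‖z‖ < 1) (w : ℂ) :
    bargmann (squeezeVec z) w = Complex.exp (z * w ^ 2 / 2) := by
  have hinner := (hasSum_squeezeVec hz).mapL (innerSL ℂ (expVec (conj w)))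
  have hexp := NormedSpace.expSeries_div_hasSum_exp (z * w ^ 2 / 2)
  rw [← Complex.exp_eq_exp_ℂ] at hexp
  refine hinner.unique (hexp.congr_fun fun k => ?_)
  have hsqrt := sqrt_factorial_ne_zero (2 * k)
  have hfact := Nat.cast_ne_zero (R := ℂ).2 k.factorial_ne_zero
  rw [innerSL_apply_apply, squeezeCoeff, inner_smul_right, inner_smul_right, inner_fock_right,
    expVec_apply]
  simp only [map_div₀, map_pow, Complex.conj_ofReal, Complex.conj_conj]
  rw [div_pow, mul_pow, pow_mul]
  field_simp

section RealParameter

variable {t : ℝ} {u : ℂ}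

theorem norm_ofReal_mul_sq_lt_one (ht0 : 0 ≤ t) (ht1 : t < 1) (hu : ‖u‖ = 1) :
    ‖t * u ^ 2‖ < 1 := by
  rwa [norm_mul, norm_pow, hu, one_pow, mul_one, Complex.norm_real, Real.norm_of_nonneg ht0]

theorem bargmann_normalDisplacement_squeezeVec (ht0 : 0 ≤ t) (ht1 : t < 1) (hu : ‖u‖ = 1) (x : ℝ)
    (w : ℂ) :
    bargmann (normalDisplacement (x * u) (squeezeVec (t * u ^ 2))) w =
      Complex.exp ((t * x ^ 2 / 2 : ℝ)) *
        Complex.exp (((1 - t) * x : ℝ) * (u * w) + t * (u * w) ^ 2 / 2) := by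
  have huu : conj u * u = 1 := by rw [Complex.conj_mul', hu, Complex.ofReal_one, one_pow]
  rw [bargmann_normalDisplacement, bargmann_squeezeVec (norm_ofReal_mul_sq_lt_one ht0 ht1 hu),
    ← Complex.exp_add, ← Complex.exp_add, map_mul, Complex.conj_ofReal]
  congr 1
  push_cast
  linear_combination (t * x ^ 2 / 2 * (conj u * u + 1) - t * x * (u * w)) * huu

/-- Along the direction of squeezing, the squeezed vector and its displacements have Fock
coefficients of the same phase, so that no cancellation occurs and the vacuum term alone bounds the
characteristic function. -/
theorem exp_le_norm_chiNormal_proj_squeezeVec (ht0 : 0 ≤ t) (ht1 : t < 1) (hu : ‖u‖ = 1) {x : ℝ}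
    (hx : 0 ≤ x) :
    Real.exp (t * x ^ 2 / 2) ≤ ‖chiNormal (proj (squeezeVec (t * u ^ 2))) (x * u)‖ := by
  set S := squeezeVec (t * u ^ 2)
  obtain ⟨d, hd, hd0, hS⟩ := exists_nonneg_apply_eq_of_bargmann_eq_exp (φ := S) (B := 0) (C := 1)
    (u := u) le_rfl ht0 fun w => by
      rw [bargmann_squeezeVec (norm_ofReal_mul_sq_lt_one ht0 ht1 hu), one_mul, Complex.ofReal_zero,
        zero_mul, zero_add, mul_pow, mul_assoc]
  obtain ⟨c, hc, hc0, hN⟩ := exists_nonneg_apply_eq_of_bargmann_eq_exp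
    (mul_nonneg (sub_nonneg.2 ht1.le) hx) ht0
    (bargmann_normalDisplacement_squeezeVec ht0 ht1 hu x)
  have hterm (n : ℕ) : inner ℂ (S n) (normalDisplacement (x * u) S n) =
      ((Real.exp (t * x ^ 2 / 2) * (n.factorial * (d n * c n)) : ℝ) : ℂ) := by
    have hun : conj u ^ n * u ^ n = 1 := by
      rw [← mul_pow, Complex.conj_mul', hu, Complex.ofReal_one, one_pow, one_pow]
    rw [RCLike.inner_apply, hS, hN, map_mul, map_mul, map_mul, Complex.conj_ofReal,
      Complex.conj_ofReal, map_pow, map_one]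
    push_cast
    rw [← sqrt_factorial_mul_self]
    linear_combination (√(n.factorial : ℝ) * √(n.factorial : ℝ) * Complex.exp (t * x ^ 2 / 2) *
      (d n * c n) : ℂ) * hun
  have hsum := Complex.hasSum_re ((lp.hasSum_inner S (normalDisplacement (x * u) S)).congr_fun
    fun n => (hterm n).symm)
  rw [← chiNormal_proj] at hsum
  refine le_trans ?_ (Complex.re_le_norm _)
  have hvacuum := le_hasSum hsum 0 fun n _ => by
    rw [Complex.ofReal_re]
    exact mul_nonneg (Real.exp_pos _).le (mul_nonneg n.factorial.cast_nonneg
      (mul_nonneg (hd n) (hc n)))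
  simpa only [Complex.ofReal_re, hd0, hc0, Nat.factorial_zero, Nat.cast_one, mul_one] using hvacuum

theorem unboundedChi_proj_squeezeVec (ht0 : 0 < t) (ht1 : t < 1) (hu : ‖u‖ = 1) :
    UnboundedChi (proj (squeezeVec (t * u ^ 2))) := by
  refine unboundedChi_of_tendsto_norm (l := atTop) (f := fun x : ℝ => x * u) ?_
  refine tendsto_atTop_mono' _ ((eventually_ge_atTop 0).mono fun x hx =>
    exp_le_norm_chiNormal_proj_squeezeVec ht0.le ht1 hu hx) ?_
  exact Real.tendsto_exp_atTop.comp
    (((tendsto_pow_atTop two_ne_zero).const_mul_atTop ht0).atTop_div_const two_pos)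

end RealParameter

theorem tanh_pos {x : ℝ} (hx : 0 < x) : 0 < Real.tanh x := by
  rw [Real.tanh_eq_sinh_div_cosh]
  exact div_pos (Real.sinh_pos_iff.2 hx) (Real.cosh_pos x)

theorem unboundedChi_squeezed {r : ℝ} (hr : r ≠ 0) : UnboundedChi (proj (squeezed r)) := by
  rw [squeezed_eq, squeezedOrbit, mul_one]
  refine unboundedChi_proj_smul ?_ ?_
  · rcases hr.lt_or_gt with hneg | hpos
    · have h := unboundedChi_proj_squeezeVec (u := 1) (tanh_pos (neg_pos.2 hneg))
        (Real.tanh_lt_one (-r)) norm_one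
      simpa using h
    · have h := unboundedChi_proj_squeezeVec (tanh_pos hpos) (Real.tanh_lt_one r)
        Complex.norm_I
      simpa using h
  · exact Complex.ofReal_ne_zero.2 (inv_ne_zero (Real.sqrt_ne_zero'.2 (Real.cosh_pos r)))

/-! ### The Weyl transform and the inversion formula -/

/-- The Gaussian `exp (-b |α|² + u α + v α*)` on phase space. -/
def gaussian (b u v α : ℂ) : ℂ := Complex.exp (-b * (conj α * α) + u * α + v * conj α)

theorem gaussian_measurableEquivPi_symm (b u v : ℂ) (p : Fin 2 → ℝ) :
    gaussian b u v (Complex.measurableEquivPi.symm p) =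
      Complex.exp (-b * ∑ i, (p i : ℂ) ^ 2 + ∑ i, ![u + v, Complex.I * (u - v)] i * p i) := by
  rw [gaussian, Complex.measurableEquivPi_symm_apply]
  simp only [Fin.sum_univ_two, Matrix.cons_val_zero, Matrix.cons_val_one, map_add, map_mul,
    Complex.conj_ofReal, Complex.conj_I]
  congr 1
  linear_combination (b * p 1 ^ 2) * Complex.I_sq

theorem integrable_gaussian {b : ℂ} (hb : 0 < b.re) (u v : ℂ) : Integrable (gaussian b u v) := by
  rw [← Complex.volume_preserving_equiv_pi.symm.integrable_comp_emb
    (MeasurableEquiv.measurableEmbedding _)]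
  exact (GaussianFourier.integrable_cexp_neg_mul_sum_add hb _).congr
    (Eventually.of_forall fun p => (gaussian_measurableEquivPi_symm b u v p).symm)

theorem integral_gaussian_eq {b : ℂ} (hb : 0 < b.re) (u v : ℂ) :
    ∫ α, gaussian b u v α = Real.pi / b * Complex.exp (u * v / b) := by
  have hb0 : b ≠ 0 := fun h => by simp [h] at hb
  rw [← Complex.volume_preserving_equiv_pi.symm.integral_comp
    (MeasurableEquiv.measurableEmbedding _)]
  simp_rw [gaussian_measurableEquivPi_symm]
  rw [GaussianFourier.integral_cexp_neg_mul_sum_add hb, Fintype.card_fin, Fin.sum_univ_two,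
    Nat.cast_ofNat, div_self two_ne_zero, Complex.cpow_one]
  congr 2
  simp only [Matrix.cons_val_zero, Matrix.cons_val_one]
  field_simp
  linear_combination (u - v) ^ 2 * Complex.I_sq

theorem continuous_expVec : Continuous expVec :=
  continuous_iff_continuousAt.2 fun β => (hasDerivAt_expVec β).continuousAt

theorem continuous_displacement_apply (x : FockSpace) : Continuous fun α => displacement α x := by
  have hspan : ∀ y ∈ Submodule.span ℂ (Set.range expVec), Continuous fun α => displacement α y := by
    intro y hy
    induction hy using Submodule.span_induction with
    | mem y hy =>
      obtain ⟨γ, rfl⟩ := hy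
      simp_rw [displacement_expVec]
      have := continuous_expVec
      have := Complex.continuous_conj
      fun_prop
    | zero => simpa using continuous_const
    | add y z _ _ hy hz => simp_rw [map_add]; exact hy.add hz
    | smul c y _ hy => simp_rw [map_smul]; exact hy.const_smul c
  refine continuous_of_uniform_approx_of_continuous fun u hu => ?_
  obtain ⟨ε, hε, hu⟩ := Metric.mem_uniformity_dist.1 hu
  obtain ⟨y, hy, hxy⟩ := Metric.mem_closure_iff.1 (dense_span_expVec x) ε hε
  refine ⟨fun α => displacement α y, hspan y hy, fun α => hu ?_⟩
  rwa [dist_eq_norm, ← map_sub, norm_displacement_apply, ← dist_eq_norm]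

theorem hasSum_integral_of_sum_norm_le {ι Ω E : Type*} [Countable ι] [MeasurableSpace Ω]
    {μ : Measure Ω} [NormedAddCommGroup E] [NormedSpace ℝ E] [CompleteSpace E]
    {F : ι → Ω → E} {f : Ω → E} {bound : Ω → ℝ}
    (hF : ∀ i, Integrable (F i) μ) (hbound : Integrable bound μ)
    (hle : ∀ ω (s : Finset ι), ∑ i ∈ s, ‖F i ω‖ ≤ bound ω)
    (hsum : ∀ ω, HasSum (fun i => F i ω) (f ω)) :
    HasSum (fun i => ∫ ω, F i ω ∂μ) (∫ ω, f ω ∂μ) := by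
  have hsummable : Summable fun i => ∫ ω, ‖F i ω‖ ∂μ := by
    refine summable_of_sum_le (c := ∫ ω, bound ω ∂μ)
      (fun i => integral_nonneg fun ω => norm_nonneg _) fun s => ?_
    rw [← integral_finsetSum s fun i _ => (hF i).norm]
    exact integral_mono (integrable_finsetSum s fun i _ => (hF i).norm) hbound fun ω => hle ω s
  have h := hasSum_integral_of_summable_integral_norm hF hsummable
  simpa only [(hsum _).tsum_eq] using h

section WeylTransform

variable {k : ℂ → ℂ}

theorem integrable_smul_displacement (hk : Integrable k) (x : FockSpace) :
    Integrable fun α => k α • displacement α x :=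
  (hk.norm.mul_const ‖x‖).mono'
    (hk.aestronglyMeasurable.smul (continuous_displacement_apply x).aestronglyMeasurable)
    (Eventually.of_forall fun α => by rw [norm_smul, norm_displacement_apply])

/-- The Weyl transform `∫ k(α) e^{α a† - α* a} d²α` of an integrable function on phase space, the
integral being taken in the strong operator topology. -/
def weylTransform (hk : Integrable k) : Op :=
  LinearMap.mkContinuous
    { toFun x := ∫ α, k α • displacement α x
      map_add' x y := by
        rw [← integral_add (integrable_smul_displacement hk x) (integrable_smul_displacement hk y)]
        simp_rw [map_add, smul_add]
      map_smul' c x := by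
        rw [RingHom.id_apply, ← integral_smul]
        simp_rw [map_smul, smul_comm c] }
    (∫ α, ‖k α‖) fun x => (norm_integral_le_integral_norm _).trans_eq <| by
      rw [← integral_mul_const]
      simp_rw [norm_smul, norm_displacement_apply]

theorem clm_weylTransform_apply (hk : Integrable k) (L : FockSpace →L[ℂ] ℂ) (x : FockSpace) :
    L (weylTransform hk x) = ∫ α, k α * L (displacement α x) := by
  refine (L.integral_comp_comm (integrable_smul_displacement hk x)).symm.trans ?_
  simp_rw [map_smul, smul_eq_mul]

theorem hasSum_inner_fock_weylTransform {T : Op} (hT : IsTraceClass T) (hk : Integrable k) :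
    HasSum (fun n => inner ℂ (fock n) (T (weylTransform hk (fock n)))) (∫ α, k α * chi T α) := by
  have hterm (n : ℕ) : inner ℂ (fock n) (T (weylTransform hk (fock n))) =
      ∫ α, k α * inner ℂ (fock n) (T (displacement α (fock n))) :=
    clm_weylTransform_apply hk (innerSL ℂ (fock n) ∘L T) (fock n)
  simp_rw [hterm]
  refine hasSum_integral_of_sum_norm_le (bound := fun α => ‖k α‖ * (traceNorm T).toReal)
    (fun n => ?_) (hk.norm.mul_const _) (fun α s => ?_)
    fun α => (hasSum_chi hT α).mul_left (k α)
  · exact ((innerSL ℂ (fock n) ∘L T).integrable_comp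
      (integrable_smul_displacement hk (fock n))).congr (Eventually.of_forall fun α => by simp)
  · simp_rw [norm_mul]
    rw [← Finset.mul_sum]
    gcongr
    rw [← ENNReal.ofReal_le_iff_le_toReal hT,
      ENNReal.ofReal_sum_of_nonneg fun _ _ => norm_nonneg _]
    simp_rw [ofReal_norm]
    exact sum_enorm_inner_le_traceNorm T orthonormal_fock (orthonormal_displacement_fock α) s

end WeylTransform

/-- The kernel of the inversion formula: up to the factor `π`, its Weyl transform is the rank one
operator `x ↦ ⟪expVec γ, x⟫ expVec β`. -/
def inversionKernel (β γ α : ℂ) : ℂ :=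
  Complex.exp (conj γ * β) * gaussian (1 / 2) (-conj γ) β α

theorem integrable_inversionKernel (β γ : ℂ) : Integrable (inversionKernel β γ) :=
  (integrable_gaussian (by norm_num) _ _).const_mul _

theorem inversionKernel_mul_inner_expVec_displacement (β γ μ ν α : ℂ) :
    inversionKernel β γ α * inner ℂ (expVec μ) (displacement α (expVec ν)) =
      Complex.exp (conj γ * β + conj μ * ν) * gaussian 1 (conj μ - conj γ) (β - ν) α := by
  rw [inner_expVec_displacement, inversionKernel, gaussian, gaussian, ← Complex.exp_add,
    ← Complex.exp_add, ← Complex.exp_add]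
  congr 1
  ring

theorem weylTransform_inversionKernel (β γ : ℂ) :
    weylTransform (integrable_inversionKernel β γ) =
      (Real.pi : ℂ) • InnerProductSpace.rankOne ℂ (expVec β) (expVec γ) := by
  refine ContinuousLinearMap.ext_on dense_span_expVec ?_
  rintro _ ⟨ν, rfl⟩
  refine eq_of_inner_expVec fun μ => ?_
  refine (clm_weylTransform_apply _ (innerSL ℂ (expVec μ)) _).trans ?_
  simp_rw [innerSL_apply_apply, inversionKernel_mul_inner_expVec_displacement]
  rw [integral_const_mul, integral_gaussian_eq (by norm_num), div_one, div_one,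
    _root_.smul_apply, inner_smul_right, InnerProductSpace.inner_right_rankOne_apply,
    inner_expVec_expVec, inner_expVec_expVec, mul_left_comm, ← Complex.exp_add, ← Complex.exp_add]
  congr 2
  ring

theorem integral_inversionKernel_mul_chi {T : Op} (hT : IsTraceClass T) (β γ : ℂ) :
    ∫ α, inversionKernel β γ α * chi T α = Real.pi * inner ℂ (expVec γ) (T (expVec β)) := by
  refine (hasSum_inner_fock_weylTransform hT (integrable_inversionKernel β γ)).unique
    (((lp.hasSum_inner (expVec γ) (T (expVec β))).mul_left (Real.pi : ℂ)).congr_fun fun n => ?_)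
  rw [weylTransform_inversionKernel, _root_.smul_apply, InnerProductSpace.rankOne_apply, map_smul,
    map_smul, inner_smul_right, inner_smul_right, inner_fock_left, inner_fock_right,
    RCLike.inner_apply, mul_comm (conj _)]

theorem eq_zero_of_chi_eq_zero {T : Op} (hT : IsTraceClass T) (h : ∀ α, chi T α = 0) : T = 0 := by
  refine ContinuousLinearMap.ext_on dense_span_expVec ?_
  rintro _ ⟨β, rfl⟩
  refine eq_of_inner_expVec fun γ => ?_
  have hinv := integral_inversionKernel_mul_chi hT β γ
  simp_rw [h, mul_zero, integral_zero] at hinv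
  rw [_root_.zero_apply, inner_zero_right]
  exact (mul_eq_zero.1 hinv.symm).resolve_left (by exact_mod_cast Real.pi_ne_zero)

theorem eq_of_chi_eq {T S : Op} (hT : IsTraceClass T) (hS : IsTraceClass S)
    (h : ∀ α, chi T α = chi S α) : T = S :=
  sub_eq_zero.1 <| eq_zero_of_chi_eq_zero (hT.sub hS) fun α => by
    rw [chi_sub hT hS, h, sub_self]

/-! ### Mixtures of coherent states -/

theorem continuous_coherent : Continuous coherent := by
  simp_rw [funext coherent_eq_smul_expVec]
  have := continuous_expVec
  have := Complex.continuous_conj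
  fun_prop

theorem continuous_proj : Continuous proj := by
  change Continuous fun ψ => (innerSL ℂ ψ).smulRight ψ
  fun_prop

section Mixture

variable {Ω : Type*} [MeasurableSpace Ω] {μ : Measure Ω}

section Integral

variable {F : Ω → Op}

theorem inner_integral_apply (hF : Integrable F μ) (x y : FockSpace) :
    inner ℂ x ((∫ ω, F ω ∂μ) y) = ∫ ω, inner ℂ x (F ω y) ∂μ := by
  rw [ContinuousLinearMap.integral_apply hF, integral_inner (hF.apply_continuousLinearMap y)]

theorem traceNorm_integral_le (hF : Integrable F μ) :
    traceNorm (∫ ω, F ω ∂μ) ≤ ∫⁻ ω, traceNorm (F ω) ∂μ := by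
  refine traceNorm_le fun N f g hf hg => ?_
  have hint (i : Fin N) : Integrable (fun ω => inner ℂ (f i) (F ω (g i))) μ :=
    (hF.apply_continuousLinearMap (g i)).const_inner (f i)
  calc ∑ i, ‖inner ℂ (f i) ((∫ ω, F ω ∂μ) (g i))‖ₑ
      ≤ ∑ i, ∫⁻ ω, ‖inner ℂ (f i) (F ω (g i))‖ₑ ∂μ := Finset.sum_le_sum fun i _ => by
        rw [inner_integral_apply hF]
        exact enorm_integral_le_lintegral_enorm _
    _ = ∫⁻ ω, ∑ i, ‖inner ℂ (f i) (F ω (g i))‖ₑ ∂μ :=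
        (lintegral_finsetSum' _ fun i _ => (hint i).aestronglyMeasurable.enorm).symm
    _ ≤ ∫⁻ ω, traceNorm (F ω) ∂μ :=
        lintegral_mono fun ω => sum_enorm_inner_le_traceNorm (F ω) hf hg _

theorem chi_integral {bound : Ω → ℝ} (hF : Integrable F μ) (hbound : Integrable bound μ)
    (hle : ∀ ω, traceNorm (F ω) ≤ ENNReal.ofReal (bound ω)) (α : ℂ) :
    chi (∫ ω, F ω ∂μ) α = ∫ ω, chi (F ω) α ∂μ := by
  have hclass (ω : Ω) : IsTraceClass (F ω) := ne_top_of_le_ne_top ENNReal.ofReal_ne_top (hle ω)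
  have hclass' : IsTraceClass (∫ ω, F ω ∂μ) := ne_top_of_le_ne_top hbound.lintegral_lt_top.ne
    ((traceNorm_integral_le hF).trans (lintegral_mono hle))
  refine (hasSum_chi hclass' α).unique ?_
  simp_rw [inner_integral_apply hF]
  refine hasSum_integral_of_sum_norm_le
    (fun n => (hF.apply_continuousLinearMap _).const_inner (fock n)) hbound.norm (fun ω s => ?_)
    fun ω => hasSum_chi (hclass ω) α
  rw [← ENNReal.ofReal_le_ofReal_iff (norm_nonneg _),
    ENNReal.ofReal_sum_of_nonneg fun _ _ => norm_nonneg _]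
  simp_rw [ofReal_norm]
  exact (sum_enorm_inner_le_traceNorm (F ω) orthonormal_fock (orthonormal_displacement_fock α)
    s).trans ((hle ω).trans (Real.ofReal_le_enorm _))

end Integral

variable [IsProbabilityMeasure μ] {b : Ω → ℂ}

theorem integrable_proj_coherent (hb : Measurable b) :
    Integrable (fun ω => proj (coherent (b ω))) μ :=
  .of_bound ((continuous_proj.comp continuous_coherent).stronglyMeasurable.comp_measurable
    hb).aestronglyMeasurable 1 <| Eventually.of_forall fun ω => by
      rw [proj, InnerProductSpace.norm_rankOne, norm_coherent, one_mul]

theorem tendsto_lintegral_norm_coherent_sub {c : ℕ → Ω → ℂ} (hb : Measurable b)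
    (hc : ∀ k, Measurable (c k)) (hlim : ∀ ω, Tendsto (fun k => c k ω) atTop (𝓝 (b ω))) :
    Tendsto (fun k => ∫⁻ ω, ENNReal.ofReal (‖coherent (b ω) - coherent (c k ω)‖ * 2) ∂μ) atTop
      (𝓝 0) := by
  have hcont : Continuous fun p : ℂ × ℂ => ‖coherent p.1 - coherent p.2‖ * 2 := by
    have := continuous_coherent
    fun_prop
  rw [← lintegral_zero (μ := μ)]
  refine tendsto_lintegral_of_dominated_convergence (fun _ => ENNReal.ofReal 4)
    (fun k => (hcont.measurable.comp (hb.prodMk (hc k))).ennreal_ofReal)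
    (fun k => Eventually.of_forall fun ω => ENNReal.ofReal_le_ofReal ?_)
    (by simp) (Eventually.of_forall fun ω => ?_)
  · have h := norm_sub_le (coherent (b ω)) (coherent (c k ω))
    rw [norm_coherent, norm_coherent] at h
    linarith
  · have h := ENNReal.tendsto_ofReal <| (hcont.tendsto (b ω, b ω)).comp <|
      tendsto_const_nhds.prodMk_nhds (hlim ω)
    rwa [sub_self, norm_zero, zero_mul, ENNReal.ofReal_zero] at h

theorem integral_simpleFunc_mem_convexHull (φ : SimpleFunc Ω ℂ) :
    ∫ ω, proj (coherent (φ ω)) ∂μ ∈ convexHull ℝ (Set.range fun α : ℂ => proj (coherent α)) := by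
  have hfin : (Set.range fun ω => proj (coherent (φ ω))).Finite :=
    (φ.finite_range.image fun β => proj (coherent β)).subset <| by
      rintro _ ⟨ω, rfl⟩
      exact ⟨φ ω, ⟨ω, rfl⟩, rfl⟩
  refine convexHull_mono ?_ ((convex_convexHull ℝ _).integral_mem (hfin.isClosed_convexHull ℝ)
    (Eventually.of_forall fun ω => subset_convexHull ℝ _ ⟨ω, rfl⟩)
    (integrable_proj_coherent φ.measurable))
  rintro _ ⟨ω, rfl⟩
  exact ⟨φ ω, rfl⟩

theorem integral_proj_coherent_mem_classicalStates (hb : Measurable b) :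
    ∫ ω, proj (coherent (b ω)) ∂μ ∈ classicalStates := by
  intro ε hε
  let φ : ℕ → SimpleFunc Ω ℂ := SimpleFunc.approxOn b hb Set.univ 0 (Set.mem_univ 0)
  have hlim := tendsto_lintegral_norm_coherent_sub (μ := μ) (c := fun k => φ k) hb
    (fun k => (φ k).measurable) fun ω =>
      SimpleFunc.tendsto_approxOn hb (Set.mem_univ 0) (by simp)
  obtain ⟨k, hk⟩ := (hlim.eventually (gt_mem_nhds hε)).exists
  have hint := integrable_proj_coherent (μ := μ) hb
  have hintφ := integrable_proj_coherent (μ := μ) (φ k).measurable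
  refine ⟨∫ ω, proj (coherent (φ k ω)) ∂μ, integral_simpleFunc_mem_convexHull (φ k), ?_⟩
  rw [← integral_sub hint hintφ]
  refine (traceNorm_integral_le (hint.sub hintφ)).trans_lt (lt_of_le_of_lt ?_ hk)
  refine lintegral_mono fun ω => (traceNorm_proj_sub_le _ _).trans_eq ?_
  rw [norm_coherent, norm_coherent, one_add_one_eq_two]

theorem chi_integral_proj_coherent (hb : Measurable b) (α : ℂ) :
    chi (∫ ω, proj (coherent (b ω)) ∂μ) α =
      Complex.exp (-(conj α * α) / 2) *
        ∫ ω, Complex.exp (α * conj (b ω) - conj α * b ω) ∂μ := by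
  rw [chi_integral (bound := fun _ => 1) (integrable_proj_coherent hb) (integrable_const 1)
    fun ω => (traceNorm_rankOne_le _ _).trans (by simp [norm_coherent]), ← integral_const_mul]
  simp_rw [chi_coherent]

end Mixture

/-! ### Gaussian states -/

/-- The phase-space point `β` representing a real-linear functional `l` through the symplectic
form, `l α = 2 Im (α β*)`. -/
def symplecticDual (l : ℂ →ₗ[ℝ] ℝ) : ℂ := ⟨l Complex.I / 2, -l 1 / 2⟩

theorem mul_conj_symplecticDual_sub (l : ℂ →ₗ[ℝ] ℝ) (α : ℂ) :
    α * conj (symplecticDual l) - conj α * symplecticDual l = l α * Complex.I := by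
  have hl : l α = l 1 * α.re + l Complex.I * α.im := by
    have hα : α.re • (1 : ℂ) + α.im • Complex.I = α := by
      rw [Complex.real_smul, Complex.real_smul, mul_one, Complex.re_add_im]
    rw [← congrArg l hα, map_add, map_smul, map_smul, smul_eq_mul, smul_eq_mul, mul_comm,
      mul_comm α.im]
  rw [hl]
  apply Complex.ext
  · simp [symplecticDual]
  · simp [symplecticDual]
    ring

theorem exists_mem_classicalStates_chi_eq {ι : Type*} [Fintype ι] (m : ℂ →ₗ[ℝ] ℝ)
    (l : ι → ℂ →ₗ[ℝ] ℝ) : ∃ τ ∈ classicalStates, ∀ α : ℂ, chi τ α =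
      Complex.exp (-(conj α * α) / 2) *
        Complex.exp (Complex.I * m α - (∑ i, l i α ^ 2 : ℝ) / 2) := by
  set b : EuclideanSpace ℝ ι → ℂ :=
    fun ω => symplecticDual m + ∑ i, ω i * symplecticDual (l i) with hb
  have hbm : Measurable b := by fun_prop
  refine ⟨_, integral_proj_coherent_mem_classicalStates (μ := stdGaussian _) hbm, fun α => ?_⟩
  rw [chi_integral_proj_coherent hbm]
  set t : EuclideanSpace ℝ ι := WithLp.toLp 2 fun i => l i α
  have hexponent (ω : EuclideanSpace ℝ ι) : α * conj (b ω) - conj α * b ω =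
      Complex.I * m α + inner ℝ ω t * Complex.I := by
    have hsum : α * conj (b ω) - conj α * b ω =
        (α * conj (symplecticDual m) - conj α * symplecticDual m) +
          ∑ i, ω i * (α * conj (symplecticDual (l i)) - conj α * symplecticDual (l i)) := by
      simp only [hb, map_add, map_sum, map_mul, Complex.conj_ofReal, mul_add, Finset.mul_sum,
        mul_sub, Finset.sum_sub_distrib, mul_left_comm]
      ring
    simp only [hsum, mul_conj_symplecticDual_sub, PiLp.inner_apply, RCLike.inner_apply,
      conj_trivial, Complex.ofReal_sum, Complex.ofReal_mul, Finset.sum_mul, t]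
    rw [mul_comm (m α : ℂ)]
    congr 1
    exact Finset.sum_congr rfl fun i _ => by ring
  simp_rw [hexponent, Complex.exp_add]
  rw [integral_const_mul, ← charFun_apply, charFun_stdGaussian, ← Complex.exp_add]
  congr 2
  rw [← Complex.ofReal_pow, EuclideanSpace.real_norm_sq_eq]
  ring

theorem exists_eq_sum_sq_of_nonneg {V : Type*} [AddCommGroup V] [Module ℝ V]
    [FiniteDimensional ℝ V] {Q : QuadraticForm ℝ V} (hQ : ∀ x, 0 ≤ Q x) :
    ∃ l : Fin (Module.finrank ℝ V) → V →ₗ[ℝ] ℝ, ∀ x, Q x = ∑ i, l i x ^ 2 := by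
  obtain ⟨w, ⟨e⟩⟩ := QuadraticForm.equivalent_weightedSumSquares Q
  have hw (i : Fin (Module.finrank ℝ V)) : 0 ≤ w i := by
    have h := hQ (e.symm (Pi.single i 1))
    rw [e.symm.map_app, QuadraticMap.weightedSumSquares_apply] at h
    simpa [Pi.single_apply] using h
  refine ⟨fun i => √(w i) • (LinearMap.proj i ∘ₗ e.toLinearEquiv.toLinearMap), fun x => ?_⟩
  rw [← e.map_app, QuadraticMap.weightedSumSquares_apply]
  refine Finset.sum_congr rfl fun i _ => ?_
  change w i • (e x i * e x i) = (√(w i) * e x i) ^ 2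
  rw [mul_pow, Real.sq_sqrt (hw i), smul_eq_mul, sq]

theorem nonneg_of_forall_le_quadraticForm {V : Type*} [AddCommGroup V] [Module ℝ V]
    {Q : QuadraticForm ℝ V} {C : ℝ} (hQ : ∀ x, C ≤ Q x) (x : V) : 0 ≤ Q x := by
  by_contra! hneg
  have hbot : Tendsto (fun t : ℝ => t ^ 2 * Q x) atTop atBot :=
    (tendsto_pow_atTop two_ne_zero).atTop_mul_const_of_neg hneg
  obtain ⟨t, ht⟩ := (hbot.eventually_lt_atBot C).exists
  have h := hQ (t • x)
  rw [QuadraticMap.map_smul, smul_eq_mul, ← sq] at h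
  exact absurd ht h.not_gt

/-- The quadratic form `Q(α) - |α|²` governing the growth of the normally ordered characteristic
function of a Gaussian state with covariance form `Q`. -/
def excessForm (Q : QuadraticForm ℝ ℂ) : QuadraticForm ℝ ℂ :=
  Q - LinearMap.BilinMap.toQuadraticMap (innerₗ ℂ)

theorem excessForm_apply (Q : QuadraticForm ℝ ℂ) (α : ℂ) : excessForm Q α = Q α - ‖α‖ ^ 2 := by
  simp [excessForm]

theorem norm_chiNormal_of_chi_eq {ρ : Op} {m : ℂ →ₗ[ℝ] ℝ} {Q : QuadraticForm ℝ ℂ} {α : ℂ}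
    (h : chi ρ α = Complex.exp (Complex.I * (m α : ℂ) - (Q α : ℂ) / 2)) :
    ‖chiNormal ρ α‖ = Real.exp (-excessForm Q α / 2) := by
  rw [norm_chiNormal, h, Complex.norm_exp, ← Real.exp_add, excessForm_apply]
  congr 1
  simp
  ring

/-- If `χ₁` is bounded then `Q - |·|²` is nonnegative, hence a sum of squares, and `ρ` has the
characteristic function of a Gaussian mixture of coherent states. -/
theorem unboundedChi_of_isGaussian {ρ : Op} (hρ : IsGaussian ρ) (hn : ρ ∉ classicalStates) :
    UnboundedChi ρ := by
  obtain ⟨hd, m, Q, hQ⟩ := hρ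
  rintro ⟨C, hC⟩
  have hnonneg : ∀ α, 0 ≤ excessForm Q α := nonneg_of_forall_le_quadraticForm (C := -(2 * C))
    fun α => by
      have h := hC ⟨α, rfl⟩
      dsimp only at h
      rw [norm_chiNormal_of_chi_eq (hQ α)] at h
      linarith [Real.add_one_le_exp (-excessForm Q α / 2)]
  obtain ⟨l, hl⟩ := exists_eq_sum_sq_of_nonneg hnonneg
  obtain ⟨τ, hτ, hchi⟩ := exists_mem_classicalStates_chi_eq m l
  suffices ρ = τ from hn (this ▸ hτ)
  refine eq_of_chi_eq hd.isTraceClass (isTraceClass_of_mem_classicalStates hτ) fun α => ?_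
  rw [hQ, hchi, ← hl, excessForm_apply, ← Complex.exp_add, Complex.conj_mul']
  congr 1
  push_cast
  ring

end

end BosonicMode

theorem mainTheorem8 :
    -- the exponentials and the traces in the statement are well defined
    (∀ α : ℂ, ∃! D : Op, IsExpOp (displacementGenerator α) D) ∧
    (∀ r : ℝ, ∃! ζ : FockSpace, IsExpVec (squeezingGenerator r) (fock 0) ζ) ∧
    (∀ ρ : Op, IsDensity ρ → ∀ α : ℂ,
      Summable fun n => (inner ℂ (fock n) ((ρ ∘L displacement α) (fock n)) : ℂ)) ∧
    -- the lower bound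
    (∀ ρ : Op, IsDensity ρ →
      ((⨆ α : ℂ, ‖chiNormal ρ α‖ₑ) + 1) / 2 ≤ nonclassicalityRobustness ρ) ∧
    -- states with unbounded characteristic function
    (∀ ρ : Op, IsDensity ρ → UnboundedChi ρ → nonclassicalityRobustness ρ = ⊤) ∧
    -- finite superpositions of Fock states other than the vacuum
    (∀ ψ : FockSpace, ψ ∈ Submodule.span ℂ (Set.range fock) → ‖ψ‖ = 1 → (∃ n : ℕ, 1 ≤ n ∧ ψ n ≠ 0) →
      IsDensity (proj ψ) ∧ UnboundedChi (proj ψ) ∧ nonclassicalityRobustness (proj ψ) = ⊤) ∧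
    -- squeezed states
    (∀ r : ℝ, r ≠ 0 →
      IsDensity (proj (squeezed r)) ∧ UnboundedChi (proj (squeezed r)) ∧
        nonclassicalityRobustness (proj (squeezed r)) = ⊤) ∧
    -- even and odd cat states
    (∀ (s : ℤˣ) (α : ℂ), α ≠ 0 →
      IsDensity (proj (cat s α)) ∧ UnboundedChi (proj (cat s α)) ∧
        nonclassicalityRobustness (proj (cat s α)) = ⊤) ∧
    -- nonclassical Gaussian states
    (∀ ρ : Op, IsGaussian ρ → ρ ∉ classicalStates →
      UnboundedChi ρ ∧ nonclassicalityRobustness ρ = ⊤) := by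
  refine ⟨existsUnique_isExpOp_displacementGenerator, existsUnique_isExpVec_squeezingGenerator,
    fun ρ hρ α => (hasSum_chi hρ.isTraceClass α).summable,
    fun ρ hρ => iSup_enorm_chiNormal_add_one_div_two_le hρ.isTraceClass,
    fun ρ hρ => nonclassicalityRobustness_eq_top hρ.isTraceClass,
    fun ψ hψ hnorm hn => isDensity_unboundedChi_robustness_proj hnorm
      (unboundedChi_proj_of_mem_span_fock hψ hn),
    fun r hr => isDensity_unboundedChi_robustness_proj (by rw [squeezed_eq, norm_squeezedOrbit])
      (unboundedChi_squeezed hr),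
    fun s α hα => isDensity_unboundedChi_robustness_proj (norm_cat s hα) (unboundedChi_cat s hα),
    fun ρ hρ hn => ?_⟩
  have h := unboundedChi_of_isGaussian hρ hn
  exact ⟨h, nonclassicalityRobustness_eq_top hρ.1.isTraceClass h⟩
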